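/- Let $d\ge 1$ and let $T:\mathbb{R}^d\to[0,\infty)$ be measurable. With $p=-i\nabla$ and $\widehat f(\eta)=(2\pi)^{-d/2}\int_{\mathbb{R}^d}e^{-i\eta\cdot x}f(x)\,dx$ (extended unitarily to $L^2(\mathbb{R}^d)$), let $m(p)$ denote the Fourier multiplier with symbol $m$, i.e. $\widehat{m(p)\varphi}=m\,\widehat\varphi$, and let $\mathcal Q(T(p))=\{\varphi\in L^2(\mathbb{R}^d;\mathbb{C}):\sqrt T\,\widehat\varphi\in L^2\}$ be the form domain of $T(p)$. Let $V:\mathbb{R}^d\to\mathbb{R}$ be measurable, not almost everywhere zero, and relatively form compact with respect to $T(p)$: $|V|^{1/2}\varphi\in L^2$ for all $\varphi\in\mathcal Q(T(p))$, and $(T(p)+1)^{-1/2}|V|(T(p)+1)^{-1/2}$ (defined through its sesquilinear form) is a compact operator on $L^2(\mathbb{R}^d)$. Let $T(p)+V$ be the operator associated with the form $\langle\sqrt{T(p)}\varphi,\sqrt{T(p)}\psi\rangle+\int V\,\overline{\varphi}\,\psi\,dx$ on $\mathcal Q(T(p))$. Let $k\in\mathbb{N}$ and suppose that $T$ has a thick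 zero set near $k$ pairwise distinct points $\omega_1,\dots,\omega_k\in\mathbb{R}^d$, that is, $\int_{B_\delta(\omega_l)}T(\eta)^{-1}\,d\eta=\infty$ for all $\delta>0$ and all $l=1,\dots,k$, where $1/0=\infty$ and $B_\delta(\omega)$ is the open ball of radius $\delta$ about $\omega$. Let $M=(\widehat V(\omega_l-\omega_m))_{l,m=1,\dots,k}$ whenever $V\in L^1(\mathbb{R}^d)$. Then $T(p)+V$ has at least $k$ strictly negative eigenvalues, counted with multiplicity, in each of the following cases: (a) $V\le 0$ almost everywhere; (b) $V\in L^1(\mathbb{R}^d)$ and $M$ is (strictly) negative definite; (c) $V\in L^1(\mathbb{R}^d)$, $T$ is locally bounded (bounded on every compact set), $M$ is negative semidefinite, and $0$ is a nondegenerate (i.e. simple) eigenvalue of $M$. -/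

import Mathlib

open MeasureTheory Filter FourierTransform ComplexConjugate
open scoped NNReal ENNReal ComplexOrder

noncomputable section

namespace ManyBoundStates

/-- The configuration space `ℝ^d` (also used as momentum space). -/
abbrev E (d : ℕ) : Type := EuclideanSpace ℝ (Fin d)

/-- The complex Hilbert space `L²(ℝ^d)`. -/
abbrev L2 (d : ℕ) : Type := Lp ℂ 2 (volume : Measure (E d))

/-- The multiplier with symbol `m`, as a function on the frequency side of Mathlib's Fourier
transform. Mathlib's `𝓕` uses the phase `exp (-2πi ⟨x, ξ⟩)`, so the momentum `p = -i∇` acts there as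
multiplication by `2πξ`; the momentum variable is `η = 2πξ`. -/
def freqMul {d : ℕ} (m : E d → ℂ) (f : L2 d) : E d → ℂ :=
  fun ξ => m ((2 * Real.pi) • ξ) * (𝓕 f : L2 d) ξ

theorem freqMul_add {d : ℕ} (m : E d → ℂ) (f g : L2 d) :
    freqMul m (f + g) =ᵐ[volume] freqMul m f + freqMul m g := by
  have h : (𝓕 (f + g) : L2 d) = 𝓕 f + 𝓕 g := (Lp.fourierTransformₗᵢ (E d) ℂ).map_add f g
  unfold freqMul
  rw [h]
  filter_upwards [Lp.coeFn_add (𝓕 f : L2 d) (𝓕 g : L2 d)] with ξ hξ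
  simp only [hξ, Pi.add_apply, mul_add]

theorem freqMul_smul {d : ℕ} (m : E d → ℂ) (c : ℂ) (f : L2 d) :
    freqMul m (c • f) =ᵐ[volume] c • freqMul m f := by
  have h : (𝓕 (c • f) : L2 d) = c • 𝓕 f := (Lp.fourierTransformₗᵢ (E d) ℂ).map_smul c f
  unfold freqMul
  rw [h]
  filter_upwards [Lp.coeFn_smul c (𝓕 f : L2 d)] with ξ hξ
  simp [hξ, mul_left_comm]

theorem freqMul_zero {d : ℕ} (m : E d → ℂ) : freqMul m (0 : L2 d) =ᵐ[volume] 0 := by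
  have h := freqMul_smul m 0 (0 : L2 d)
  simpa using h

/-- The Fourier multiplier `m(p) = 𝓕⁻¹ m(·) 𝓕` as an unbounded operator on `L²(ℝ^d)`, on its
maximal domain `{f ∈ L² | m · f̂ ∈ L²}`. -/
def fourierMultiplier {d : ℕ} (m : E d → ℂ) : L2 d →ₗ.[ℂ] L2 d where
  domain :=
    { carrier := {f | MemLp (freqMul m f) 2 volume}
      add_mem' := fun {f g} hf hg =>
        (memLp_congr_ae (freqMul_add m f g)).2 (MemLp.add hf hg)
      zero_mem' := (memLp_congr_ae (freqMul_zero m)).2 MemLp.zero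
      smul_mem' := fun c f hf =>
        (memLp_congr_ae (freqMul_smul m c f)).2 (MemLp.const_smul hf c) }
  toFun :=
    { toFun := fun f => (𝓕⁻ (MemLp.toLp (freqMul m f.1) f.2 : L2 d) : L2 d)
      map_add' := fun f g => by
        have h : (MemLp.toLp (freqMul m (f + g).1) (f + g).2 : L2 d)
            = MemLp.toLp (freqMul m f.1) f.2 + MemLp.toLp (freqMul m g.1) g.2 := by
          rw [← MemLp.toLp_add]
          exact MemLp.toLp_congr _ _ (freqMul_add m f.1 g.1)
        rw [h]
        exact (Lp.fourierTransformₗᵢ (E d) ℂ).symm.map_add _ _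
      map_smul' := fun c f => by
        have h : (MemLp.toLp (freqMul m (c • f).1) (c • f).2 : L2 d)
            = c • MemLp.toLp (freqMul m f.1) f.2 := by
          rw [← MemLp.toLp_const_smul]
          exact MemLp.toLp_congr _ _ (freqMul_smul m c f.1)
        rw [h]
        exact (Lp.fourierTransformₗᵢ (E d) ℂ).symm.map_smul _ _ }

/-- The operator `√(T(p))`. -/
def sqrtKinetic {d : ℕ} (T : E d → ℝ≥0) : L2 d →ₗ.[ℂ] L2 d :=
  fourierMultiplier fun η => ((Real.sqrt (T η) : ℝ) : ℂ)

/-- The operator `(T(p) + 1)^{-1/2}`; its symbol is bounded by `1`, so for measurable `T` it is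
defined on all of `L²`. -/
def invSqrtKinetic {d : ℕ} (T : E d → ℝ≥0) : L2 d →ₗ.[ℂ] L2 d :=
  fourierMultiplier fun η => (((Real.sqrt ((T η : ℝ) + 1))⁻¹ : ℝ) : ℂ)

/-- The quadratic form domain `Q(T(p))`. -/
abbrev formDomain {d : ℕ} (T : E d → ℝ≥0) : Submodule ℂ (L2 d) := (sqrtKinetic T).domain

/-- `φ ∈ Q(V)`, i.e. `|V|^{1/2} φ ∈ L²`. -/
def InPotentialFormDomain {d : ℕ} (V : E d → ℝ) (φ : L2 d) : Prop :=
  MemLp (fun x => ((Real.sqrt |V x| : ℝ) : ℂ) * φ x) 2 volume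

/-- `V` is relatively form compact with respect to `T(p)`: one has `Q(T(p)) ⊆ Q(V)`, and the
operator `(T(p)+1)^{-1/2} |V| (T(p)+1)^{-1/2}`, understood through its sesquilinear form
`(f, g) ↦ ∫ |V| conj((T(p)+1)^{-1/2} f) (T(p)+1)^{-1/2} g`, is a compact operator on `L²`. -/
def RelativelyFormCompact {d : ℕ} (T : E d → ℝ≥0) (V : E d → ℝ) : Prop :=
  (∀ φ ∈ formDomain T, InPotentialFormDomain V φ) ∧
  ∃ K : L2 d →L[ℂ] L2 d, IsCompactOperator K ∧
    ∀ f g : (invSqrtKinetic T).domain,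
      inner ℂ (f : L2 d) (K g) =
        ∫ x, ((|V x| : ℝ) : ℂ) * (conj (invSqrtKinetic T f x) * invSqrtKinetic T g x)

/-- The form sum of `T(p)` and `V` on `Q(T(p))`:
`⟨√T(p) φ, √T(p) ψ⟩ + ∫ V conj(φ) ψ`. -/
def schrodingerForm {d : ℕ} (T : E d → ℝ≥0) (V : E d → ℝ) (φ ψ : formDomain T) : ℂ :=
  inner ℂ (sqrtKinetic T φ) (sqrtKinetic T ψ) +
    ∫ x, (V x : ℂ) * (conj ((φ : L2 d) x) * (ψ : L2 d) x)

/-- The graph of the operator `T(p) + V` associated with the form sum: `(ψ, g)` belongs to it iff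
`ψ ∈ Q(T(p))` and the form satisfies `q(φ, ψ) = ⟨φ, g⟩` for all `φ ∈ Q(T(p))`. -/
def schrodingerGraph {d : ℕ} (T : E d → ℝ≥0) (V : E d → ℝ) : Set (L2 d × L2 d) :=
  {p | ∃ ψ : formDomain T, (ψ : L2 d) = p.1 ∧
    ∀ φ : formDomain T, schrodingerForm T V φ ψ = inner ℂ (φ : L2 d) p.2}

/-- `T(p) + V` has at least `k` strictly negative eigenvalues, counted with multiplicity: there are
`k` linearly independent eigenvectors with strictly negative eigenvalues. -/
def HasAtLeastNegativeEigenvalues {d : ℕ} (T : E d → ℝ≥0) (V : E d → ℝ) (k : ℕ) : Prop :=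
  ∃ (μ : Fin k → ℝ) (ψ : Fin k → L2 d), LinearIndependent ℂ ψ ∧
    ∀ j, μ j < 0 ∧ (ψ j, (μ j : ℂ) • ψ j) ∈ schrodingerGraph T V

/-- `T` has a thick zero set near `ω`: the integral of `1/T` (with `1/0 = ∞`) over every open ball
centred at `ω` is infinite. -/
def ThickZeroSetNear {d : ℕ} (T : E d → ℝ≥0) (ω : E d) : Prop :=
  ∀ δ : ℝ, 0 < δ → ∫⁻ η in Metric.ball ω δ, ((T η : ℝ≥0∞))⁻¹ = ∞

/-- `T` is locally bounded, i.e. bounded on every compact set. -/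
def LocallyBounded {d : ℕ} (T : E d → ℝ≥0) : Prop :=
  ∀ C : Set (E d), IsCompact C → BddAbove (T '' C)

/-- The Fourier transform `V̂(η) = (2π)^{-d/2} ∫ e^{-iη·x} V(x) dx` of a potential `V ∈ L¹`. -/
def potentialHat {d : ℕ} (V : E d → ℝ) (η : E d) : ℂ :=
  (((2 * Real.pi) ^ (-(d : ℝ) / 2) : ℝ) : ℂ) *
    ∫ x, Complex.exp (-Complex.I * ((inner ℝ η x : ℝ) : ℂ)) * (V x : ℂ)

/-- The `k × k` matrix `(V̂(ω_l - ω_m))_{l,m}`. -/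
def potentialMatrix {d k : ℕ} (V : E d → ℝ) (ω : Fin k → E d) : Matrix (Fin k) (Fin k) ℂ :=
  Matrix.of fun l m => potentialHat V (ω l - ω m)

end ManyBoundStates

end

/-! ### Abstract min-max: compact perturbations and negative eigenvalues -/

section Variational

open Topology

variable {H G : Type*} [NormedAddCommGroup H] [InnerProductSpace ℂ H]
  [NormedAddCommGroup G] [InnerProductSpace ℂ G]

/-! A thick zero of `T` allows localisation in momentum space at almost no kinetic cost. The density
proportional to `1/(T+ε)` on a small ball, normalised to integral one, has kinetic energy at most
the reciprocal of the integral of `1/(T+ε)`, and this is as small as desired because `1/T` has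
infinite integral (`exists_concentrated_density`). As the balls shrink to `ω`, the inverse Fourier
transforms converge boundedly to the plane wave `exp (i ω · x)` (`exists_trial_sequence`).

For `c` in `ℂ^k`, let `p_c = ∑ c_l exp (i ω_l · x)`. The energy of the corresponding combination of
trial functions then tends to `∫ V |p_c|²` for integrable `V`, which is a positive multiple of `c* M
c` (`dotProduct_potentialMatrix_mulVec`). Compactness of the unit sphere of `ℂ^k` carries negative
definiteness of the limit over to one fixed stage of the approximation
(`hasAtLeastNegativeEigenvalues_of_limit`). This is case (b). In case (a), `V` is replaced by an
integrable `W` with `V ≤ W ≤ 0` and the same zeros; strictness holds because a nontrivial `p_c`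
vanishes only on a null set. In case (c), the limit form degenerates on one line, and a multiple of
a fixed form-domain vector `χ`, coupled to that line, is added; it lowers the energy to first order
(`exists_perturbation_neg`).

A form negative definite on `k` dimensions yields `k` negative eigenvalues by a variational
argument. With `R = (T(p)+1)^{-1/2}` and `φ = R f`, the form becomes `‖f‖² - ‖R f‖² + ⟨f, K f⟩` with
`K` compact and symmetric, and the eigenvalue equation becomes `(1 - (1+E) R*R + K) f = 0`, an
equation between bounded operators. Ground states exist by compactness (`exists_ground_state`) and
are split off one at a time (`exists_orthonormal_eigenvectors`). -/

/-- A continuous linear map is sequentially compact if it maps bounded sequences to sequences with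
a convergent subsequence. -/
def SeqCompactOperator (K : H →L[ℂ] G) : Prop :=
  ∀ u : ℕ → H, (∃ C : ℝ, ∀ n, ‖u n‖ ≤ C) →
    ∃ (φ : ℕ → ℕ) (y : G), StrictMono φ ∧ Tendsto (fun n => K (u (φ n))) atTop (𝓝 y)

theorem IsCompactOperator.seqCompactOperator {K : H →L[ℂ] G} (hK : IsCompactOperator K) :
    SeqCompactOperator K := by
  rintro u ⟨C, hC⟩
  obtain ⟨S, hS, hsub⟩ := IsCompactOperator.image_closedBall_subset_compact
    (f := (K : H →ₗ[ℂ] G)) hK C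
  obtain ⟨y, -, φ, hφ, hy⟩ := hS.tendsto_subseq (x := fun n => K (u n))
    (fun n => hsub ⟨u n, by simpa using hC n, rfl⟩)
  exact ⟨φ, y, hφ, hy⟩

/-- The energy `‖f‖² - ‖R f‖² + re ⟨f, K f⟩`. -/
noncomputable def energy (R : H →L[ℂ] G) (K : H →L[ℂ] H) (f : H) : ℝ :=
  ‖f‖ ^ 2 - ‖R f‖ ^ 2 + (inner ℂ f (K f)).re

theorem energy_smul (R : H →L[ℂ] G) (K : H →L[ℂ] H) (c : ℂ) (f : H) :
    energy R K (c • f) = ‖c‖ ^ 2 * energy R K f := by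
  have h : inner ℂ (c • f) (K (c • f)) = ((‖c‖ ^ 2 : ℝ) : ℂ) * inner ℂ f (K f) := by
    rw [map_smul, inner_smul_left, inner_smul_right, ← mul_assoc, Complex.conj_mul']
    push_cast; rfl
  rw [energy, h, Complex.re_ofReal_mul, map_smul, norm_smul, norm_smul, energy]
  ring

/-- A positive operator `B` satisfies `‖B f‖² ≤ (‖B‖ + 1) re ⟨f, B f⟩`. -/
theorem norm_sq_apply_le_of_nonneg (B : H →L[ℂ] H)
    (hsymm : ∀ f g, inner ℂ (B f) g = inner ℂ f (B g))
    (hpos : ∀ f, 0 ≤ (inner ℂ f (B f)).re) (f : H) :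
    ‖B f‖ ^ 2 ≤ (‖B‖ + 1) * (inner ℂ f (B f)).re := by
  -- Positivity is tested on `f - t B f`; the `+ 1` keeps `t` finite and positive when `B = 0`.
  set t : ℝ := (‖B‖ + 1)⁻¹ with ht
  have hb : 0 ≤ ‖B‖ := norm_nonneg _
  have htpos : 0 < t := by positivity
  have ht1 : t * (‖B‖ + 1) = 1 := inv_mul_cancel₀ (by positivity)
  have h := hpos (f - (t : ℂ) • B f)
  have e1 : (inner ℂ (B f) (B f)).re = ‖B f‖ ^ 2 := by
    rw [inner_self_eq_norm_sq_to_K]; norm_cast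
  have e2 : (inner ℂ (B f) (B (B f))).re ≤ ‖B‖ * ‖B f‖ ^ 2 := by
    calc _ ≤ ‖inner ℂ (B f) (B (B f))‖ := Complex.re_le_norm _
      _ ≤ ‖B f‖ * ‖B (B f)‖ := norm_inner_le_norm _ _
      _ ≤ ‖B f‖ * (‖B‖ * ‖B f‖) := by gcongr; exact B.le_opNorm _
      _ = _ := by ring
  have e3 : (inner ℂ (f - (t : ℂ) • B f) (B (f - (t : ℂ) • B f))).re
      = (inner ℂ f (B f)).re - 2 * t * ‖B f‖ ^ 2 + t ^ 2 * (inner ℂ (B f) (B (B f))).re := by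
    rw [← e1]
    simp only [map_sub, map_smul, inner_sub_left, inner_sub_right, inner_smul_left,
      inner_smul_right, ← hsymm f (B f), Complex.conj_ofReal, Complex.sub_re, Complex.re_ofReal_mul]
    ring
  rw [e3] at h
  have h4 : t ^ 2 * (inner ℂ (B f) (B (B f))).re ≤ t * ‖B f‖ ^ 2 := by
    calc _ ≤ t ^ 2 * (‖B‖ * ‖B f‖ ^ 2) := by gcongr
      _ ≤ t ^ 2 * ((‖B‖ + 1) * ‖B f‖ ^ 2) := by gcongr; linarith
      _ = (t * (‖B‖ + 1)) * (t * ‖B f‖ ^ 2) := by ring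
      _ = _ := by rw [ht1, one_mul]
  have h5 : t * ‖B f‖ ^ 2 ≤ (inner ℂ f (B f)).re := by linarith
  calc ‖B f‖ ^ 2 = (t * (‖B‖ + 1)) * ‖B f‖ ^ 2 := by rw [ht1, one_mul]
    _ = (‖B‖ + 1) * (t * ‖B f‖ ^ 2) := by ring
    _ ≤ _ := by gcongr

variable [CompleteSpace H] [CompleteSpace G]

/-- A compact form is infinitesimally bounded with respect to an injective bounded operator. -/
theorem exists_compact_form_bound (R : H →L[ℂ] G) (hR : Function.Injective R) (K : H →L[ℂ] H)
    (hsymm : ∀ f g, inner ℂ (K f) g = inner ℂ f (K g)) (hK : SeqCompactOperator K) :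
    ∃ C : ℝ, ∀ f, ‖inner ℂ f (K f)‖ ≤ 1 / 2 * ‖f‖ ^ 2 + C * ‖R f‖ ^ 2 := by
  -- Failure for every `C = n` gives unit vectors `u n` with `R (u n) → 0`. They tend weakly to
  -- zero, so `K (u n) → 0` along a subsequence, against the lower bound `1/2`.
  by_contra! hcon
  have hn : ∀ n : ℕ, ∃ f : H, ‖f‖ = 1 ∧
      1 / 2 + n * ‖R f‖ ^ 2 < ‖inner ℂ f (K f)‖ := by
    intro n
    obtain ⟨f, hf⟩ := hcon n
    have hf0 : f ≠ 0 := by rintro rfl; simp at hf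
    have hnf : 0 < ‖f‖ := norm_pos_iff.2 hf0
    refine ⟨((‖f‖⁻¹ : ℝ) : ℂ) • f, by simp [norm_smul, hnf.ne'], ?_⟩
    have e : ‖inner ℂ (((‖f‖⁻¹ : ℝ) : ℂ) • f) (K (((‖f‖⁻¹ : ℝ) : ℂ) • f))‖
        = (‖f‖⁻¹) ^ 2 * ‖inner ℂ f (K f)‖ := by
      rw [map_smul, inner_smul_left, inner_smul_right, norm_mul, norm_mul]
      simp; ring
    rw [e, map_smul, norm_smul, mul_pow]
    have e2 : ‖((‖f‖⁻¹ : ℝ) : ℂ)‖ = ‖f‖⁻¹ := by simp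
    rw [e2]
    calc 1 / 2 + n * ((‖f‖⁻¹) ^ 2 * ‖R f‖ ^ 2)
        = (‖f‖⁻¹) ^ 2 * (1 / 2 * ‖f‖ ^ 2 + n * ‖R f‖ ^ 2) := by
          field_simp
      _ < _ := by gcongr
  choose u hu1 hu2 using hn
  have hRle : ∀ n : ℕ, (n : ℝ) * ‖R (u n)‖ ^ 2 ≤ ‖K‖ := by
    intro n
    have : ‖inner ℂ (u n) (K (u n))‖ ≤ ‖K‖ := by
      calc _ ≤ ‖u n‖ * ‖K (u n)‖ := norm_inner_le_norm _ _
        _ ≤ ‖u n‖ * (‖K‖ * ‖u n‖) := by gcongr; exact K.le_opNorm _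
        _ = _ := by rw [hu1]; ring
    linarith [hu2 n]
  have hR0 : Tendsto (fun n => ‖R (u n)‖) atTop (𝓝 0) := by
    have h2 : Tendsto (fun n => ‖R (u n)‖ ^ 2) atTop (𝓝 0) := by
      refine squeeze_zero' (Eventually.of_forall fun n => by positivity) ?_
        (tendsto_const_div_atTop_nhds_zero_nat ‖K‖)
      filter_upwards [eventually_gt_atTop 0] with n hn0
      rw [le_div_iff₀ (by exact_mod_cast hn0)]
      linarith [hRle n]
    simpa using h2.sqrt
  obtain ⟨φ, y, hφ, hy⟩ := hK u ⟨1, fun n => (hu1 n).le⟩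
  -- Injectivity of `R` makes the range of its adjoint dense. Weak convergence thus only has to be
  -- tested against vectors `R* w`, where it follows from `R (u n) → 0`.
  have hdense : Dense ((LinearMap.range (R.adjoint : G →ₗ[ℂ] H) : Submodule ℂ H) : Set H) := by
    rw [Submodule.dense_iff_topologicalClosure_eq_top, Submodule.topologicalClosure_eq_top_iff]
    rw [Submodule.eq_bot_iff]
    intro x hx
    apply hR
    rw [map_zero, ← inner_self_eq_zero (𝕜 := ℂ), ← ContinuousLinearMap.adjoint_inner_left]
    exact hx _ ⟨R x, rfl⟩
  have hweak : ∀ h : H, Tendsto (fun n => inner ℂ h (u (φ n))) atTop (𝓝 0) := by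
    intro h
    rw [Metric.tendsto_atTop]
    intro ε hε
    obtain ⟨_, hz, w, rfl⟩ := Metric.dense_iff.1 hdense h (ε / 2) (by positivity)
    have h1 : Tendsto (fun n => ‖w‖ * ‖R (u (φ n))‖) atTop (𝓝 0) := by
      simpa using (hR0.comp hφ.tendsto_atTop).const_mul ‖w‖
    obtain ⟨N, hN⟩ := (Metric.tendsto_atTop.1 h1) (ε / 2) (by positivity)
    refine ⟨N, fun n hn => ?_⟩
    have h2 := hN n hn
    rw [Real.dist_eq, sub_zero, abs_of_nonneg (by positivity)] at h2
    rw [Metric.mem_ball, dist_eq_norm] at hz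
    have e : inner ℂ h (u (φ n)) = inner ℂ w (R (u (φ n)))
        - inner ℂ ((R.adjoint : G →ₗ[ℂ] H) w - h) (u (φ n)) := by
      rw [inner_sub_left]
      have : inner ℂ ((R.adjoint : G →ₗ[ℂ] H) w) (u (φ n)) = inner ℂ w (R (u (φ n))) :=
        ContinuousLinearMap.adjoint_inner_left _ _ _
      rw [this]; ring
    rw [dist_zero_right, e]
    calc _ ≤ ‖inner ℂ w (R (u (φ n)))‖
          + ‖inner ℂ ((R.adjoint : G →ₗ[ℂ] H) w - h) (u (φ n))‖ := norm_sub_le _ _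
      _ ≤ ‖w‖ * ‖R (u (φ n))‖ + ‖(R.adjoint : G →ₗ[ℂ] H) w - h‖ * ‖u (φ n)‖ :=
          add_le_add (norm_inner_le_norm _ _) (norm_inner_le_norm _ _)
      _ < ε := by rw [hu1, mul_one]; linarith
  have hy0 : y = 0 := by
    rw [← inner_self_eq_zero (𝕜 := ℂ)]
    have h1 : Tendsto (fun n => inner ℂ y (K (u (φ n)))) atTop (𝓝 (inner ℂ y y)) :=
      tendsto_const_nhds.inner hy
    have h2 : Tendsto (fun n => inner ℂ y (K (u (φ n)))) atTop (𝓝 0) := by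
      simpa only [hsymm] using hweak (K y)
    exact tendsto_nhds_unique h1 h2
  rw [hy0] at hy
  have h3 : ∀ n, (1 / 2 : ℝ) ≤ ‖K (u (φ n))‖ := by
    intro n
    have h4 := hu2 (φ n)
    have h5 : ‖inner ℂ (u (φ n)) (K (u (φ n)))‖ ≤ ‖K (u (φ n))‖ := by
      simpa [hu1] using norm_inner_le_norm (𝕜 := ℂ) (u (φ n)) (K (u (φ n)))
    have : 0 ≤ (φ n : ℝ) * ‖R (u (φ n))‖ ^ 2 := by positivity
    linarith
  have h6 := ge_of_tendsto' hy.norm h3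
  norm_num at h6

/-- The Schrödinger operator in the variable `f`, shifted by `E`. -/
noncomputable def shiftedOperator (R : H →L[ℂ] G) (K : H →L[ℂ] H) (E : ℝ) : H →L[ℂ] H :=
  ContinuousLinearMap.id ℂ H - ((1 + E : ℝ) : ℂ) • (R.adjoint ∘L R) + K

theorem inner_shiftedOperator (R : H →L[ℂ] G) (K : H →L[ℂ] H) (E : ℝ) (g f : H) :
    inner ℂ g (shiftedOperator R K E f) =
      inner ℂ g f - ((1 + E : ℝ) : ℂ) * inner ℂ (R g) (R f) + inner ℂ g (K f) := by
  simp only [shiftedOperator, add_apply, sub_apply, smul_apply,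
    ContinuousLinearMap.comp_apply, ContinuousLinearMap.id_apply,
    inner_add_right, inner_sub_right, inner_smul_right, ContinuousLinearMap.adjoint_inner_right]

theorem shiftedOperator_symm (R : H →L[ℂ] G) (K : H →L[ℂ] H) (E : ℝ)
    (hsymm : ∀ f g, inner ℂ (K f) g = inner ℂ f (K g)) (f g : H) :
    inner ℂ (shiftedOperator R K E f) g = inner ℂ f (shiftedOperator R K E g) := by
  rw [← inner_conj_symm, inner_shiftedOperator, inner_shiftedOperator, ← hsymm f g]
  simp only [map_add, map_sub, map_mul, Complex.conj_ofReal, inner_conj_symm]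

/-- Links the two pictures: when `E` is the infimum of the energy on `‖R f‖ = 1`, the shifted
operator is nonnegative and its form tends to zero along minimising sequences. -/
theorem re_inner_shiftedOperator (R : H →L[ℂ] G) (K : H →L[ℂ] H) (E : ℝ) (f : H) :
    (inner ℂ f (shiftedOperator R K E f)).re = energy R K f - E * ‖R f‖ ^ 2 := by
  rw [inner_shiftedOperator, inner_self_eq_norm_sq_to_K, inner_self_eq_norm_sq_to_K, energy]
  simp only [Complex.add_re, Complex.sub_re, Complex.re_ofReal_mul]
  norm_cast
  simp only [Complex.ofReal_re, Complex.coe_algebraMap]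
  ring

/-- If the energy is negative somewhere, then it has a ground state with negative energy. -/
theorem exists_ground_state (R : H →L[ℂ] G) (hR : Function.Injective R)
    (hR1 : ∀ f, ‖R f‖ ≤ ‖f‖) (K : H →L[ℂ] H)
    (hsymm : ∀ f g, inner ℂ (K f) g = inner ℂ f (K g)) (hK : SeqCompactOperator K)
    (hneg : ∃ f, energy R K f < 0) :
    ∃ (E : ℝ) (f : H), E < 0 ∧ ‖R f‖ = 1 ∧ shiftedOperator R K E f = 0 := by
  obtain ⟨C, hC⟩ := exists_compact_form_bound R hR K hsymm hK
  -- Used twice: the infimum over `‖R f‖ = 1` is finite, and minimising sequences are bounded in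
  -- `H`, although the constraint only controls `R f`.
  have hlow : ∀ f, 1 / 2 * ‖f‖ ^ 2 - (1 + C) * ‖R f‖ ^ 2 ≤ energy R K f := by
    intro f
    have h1 := hC f
    have h2 := neg_le_of_abs_le (Complex.abs_re_le_norm (inner ℂ f (K f)))
    rw [energy]
    linarith
  set S : Set ℝ := (fun f => energy R K f) '' {f | ‖R f‖ = 1} with hS
  have hbdd : BddBelow S := by
    refine ⟨-(1 + C), ?_⟩
    rintro _ ⟨f, hf, rfl⟩
    have h := hlow f
    rw [Set.mem_ofPred_eq] at hf
    rw [hf] at h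
    have : 0 ≤ ‖f‖ ^ 2 := by positivity
    simp only
    linarith
  obtain ⟨f₀, hf₀⟩ := hneg
  have hf0 : f₀ ≠ 0 := by rintro rfl; simp [energy] at hf₀
  have hRf0 : 0 < ‖R f₀‖ := norm_pos_iff.2 fun h => hf0 (hR (by rw [h, map_zero]))
  have hmem : energy R K (((‖R f₀‖⁻¹ : ℝ) : ℂ) • f₀) ∈ S :=
    ⟨_, by simp [norm_smul, hRf0.ne'], rfl⟩
  have hE : sInf S < 0 := by
    refine (csInf_le hbdd hmem).trans_lt ?_
    rw [energy_smul]
    exact mul_neg_of_pos_of_neg (by simp; positivity) hf₀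
  set E := sInf S with hEdef
  obtain ⟨e, -, he, heS⟩ := exists_seq_tendsto_sInf ⟨_, hmem⟩ hbdd
  choose u hu1 hu2 using heS
  have hnonneg : ∀ f, 0 ≤ (inner ℂ f (shiftedOperator R K E f)).re := by
    intro f
    rw [re_inner_shiftedOperator]
    by_cases hf : f = 0
    · subst hf; simp [energy]
    have hRf : 0 < ‖R f‖ := norm_pos_iff.2 fun h => hf (hR (by rw [h, map_zero]))
    have h1 : E ≤ energy R K (((‖R f‖⁻¹ : ℝ) : ℂ) • f) :=
      csInf_le hbdd ⟨_, by simp [norm_smul, hRf.ne'], rfl⟩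
    rw [energy_smul] at h1
    have h2 : ‖((‖R f‖⁻¹ : ℝ) : ℂ)‖ = ‖R f‖⁻¹ := by simp
    rw [h2, inv_pow, ← div_eq_inv_mul, le_div_iff₀ (by positivity)] at h1
    linarith
  set B := shiftedOperator R K E with hB
  -- For the nonnegative operator `B`, smallness of the form `⟨u, B u⟩` forces smallness of `B u`
  -- itself, so a minimising sequence is an approximate null sequence.
  have hB0 : Tendsto (fun n => B (u n)) atTop (𝓝 0) := by
    rw [tendsto_zero_iff_norm_tendsto_zero]
    have h1 : Tendsto (fun n => (‖B‖ + 1) * (e n - E)) atTop (𝓝 0) := by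
      simpa [← hEdef] using (he.sub_const E).const_mul (‖B‖ + 1)
    have h2 : Tendsto (fun n => ‖B (u n)‖ ^ 2) atTop (𝓝 0) := by
      refine squeeze_zero (fun n => by positivity) (fun n => ?_) h1
      refine (norm_sq_apply_le_of_nonneg B (shiftedOperator_symm R K E hsymm) hnonneg _).trans ?_
      rw [hB, re_inner_shiftedOperator, hu1 n]
      have := hu2 n
      simp only at this
      rw [this]; simp
    simpa using h2.sqrt
  have hubdd : ∃ C', ∀ n, ‖u n‖ ≤ C' := by
    obtain ⟨D, hD⟩ := he.bddAbove_range
    refine ⟨2 * (D + 1 + C) + 1, fun n => ?_⟩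
    have h1 := hlow (u n)
    have h2 : energy R K (u n) ≤ D := by
      have := hu2 n
      simp only at this
      rw [this]; exact hD ⟨n, rfl⟩
    rw [hu1 n] at h1
    nlinarith [norm_nonneg (u n), sq_nonneg (‖u n‖ - 1)]
  obtain ⟨φ, y, hφ, hy⟩ := hK u hubdd
  -- `A = B - K` is coercive because `E < 0` and `‖R f‖ ≤ ‖f‖`. Since `B u → 0` and `K u` converges
  -- along the subsequence, `A u` converges, and coercivity makes the subsequence of `u` itself
  -- Cauchy.
  set A := shiftedOperator R (0 : H →L[ℂ] H) E with hA
  have hAB : ∀ f, A f = B f - K f := by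
    intro f; simp [hA, hB, shiftedOperator]
  have hAu : Tendsto (fun n => A (u (φ n))) atTop (𝓝 (0 - y)) := by
    simp only [hAB]
    exact (hB0.comp hφ.tendsto_atTop).sub hy
  set c := min 1 (-E) with hc
  have hcpos : 0 < c := lt_min one_pos (by linarith)
  have hAlow : ∀ f, c * ‖f‖ ≤ ‖A f‖ := by
    intro f
    have h1 : c * ‖f‖ ^ 2 ≤ (inner ℂ f (A f)).re := by
      rw [hA, re_inner_shiftedOperator, energy]
      simp only [zero_apply, inner_zero_right, Complex.zero_re]
      have h2 : ‖R f‖ ^ 2 ≤ ‖f‖ ^ 2 := by gcongr; exact hR1 f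
      have h3 : c ≤ 1 := min_le_left _ _
      have h4 : c ≤ -E := min_le_right _ _
      have h5 : 0 ≤ ‖R f‖ ^ 2 := by positivity
      rcases le_total (1 + E) 0 with h | h
      · nlinarith
      · nlinarith
    have h2 : (inner ℂ f (A f)).re ≤ ‖f‖ * ‖A f‖ :=
      (Complex.re_le_norm _).trans (norm_inner_le_norm _ _)
    rcases (norm_nonneg f).eq_or_lt with h | h
    · rw [← h]; simp
    · nlinarith
  have hAanti : AntilipschitzWith (Real.toNNReal c⁻¹) A := by
    refine AddMonoidHomClass.antilipschitz_of_bound A fun f => ?_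
    rw [Real.coe_toNNReal _ (by positivity), ← div_eq_inv_mul, le_div_iff₀ hcpos]
    linarith [hAlow f]
  have hcauchy : CauchySeq fun n => u (φ n) := by
    have h := hAu.cauchySeq
    rw [CauchySeq] at h ⊢
    exact (hAanti.isUniformInducing A.uniformContinuous).cauchy_map_iff.1
      (by rwa [Filter.map_map])
  obtain ⟨f, hf⟩ := cauchySeq_tendsto_of_complete hcauchy
  refine ⟨E, f, hE, ?_, ?_⟩
  · refine tendsto_nhds_unique ((R.continuous.tendsto f).comp hf).norm ?_
    have h1 : ∀ n, ‖R (u n)‖ = 1 := hu1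
    simp [h1]
  · exact tendsto_nhds_unique ((B.continuous.tendsto f).comp hf) (hB0.comp hφ.tendsto_atTop)

/-- If the energy is negative on a `k`-dimensional space, there are `j ≤ k` eigenvectors with
negative eigenvalues, orthonormal for the form `⟨R ·, R ·⟩`. -/
theorem exists_orthonormal_eigenvectors (R : H →L[ℂ] G) (hR : Function.Injective R)
    (hR1 : ∀ f, ‖R f‖ ≤ ‖f‖) (K : H →L[ℂ] H)
    (hsymm : ∀ f g, inner ℂ (K f) g = inner ℂ f (K g)) (hK : SeqCompactOperator K)
    {k : ℕ} (F : (Fin k → ℂ) →ₗ[ℂ] H) (hF : ∀ c, c ≠ 0 → energy R K (F c) < 0)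
    (j : ℕ) (hj : j ≤ k) :
    ∃ (E : Fin j → ℝ) (f : Fin j → H), Orthonormal ℂ (fun i => R (f i)) ∧
      ∀ i, E i < 0 ∧ shiftedOperator R K (E i) (f i) = 0 := by
  induction j with
  | zero => exact ⟨Fin.elim0, Fin.elim0, ⟨fun i => i.elim0, fun i => i.elim0⟩, fun i => i.elim0⟩
  | succ j ih =>
    obtain ⟨E, f, hf, hEf⟩ := ih (by omega)
    set Λ : H →L[ℂ] (Fin j → ℂ) :=
      ContinuousLinearMap.pi fun i => (innerSL ℂ (R (f i))) ∘L R with hΛ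
    have hΛapp : ∀ g i, Λ g i = inner ℂ (R (f i)) (R g) := fun g i => rfl
    set W : Submodule ℂ H := LinearMap.ker (Λ : H →ₗ[ℂ] (Fin j → ℂ)) with hW
    have hWmem : ∀ g, g ∈ W ↔ ∀ i, inner ℂ (R (f i)) (R g) = 0 := by
      intro g
      rw [hW, LinearMap.mem_ker]
      exact funext_iff
    have hclosed : IsClosed (W : Set H) := Λ.isClosed_ker
    have : CompleteSpace W := hclosed.completeSpace_coe
    -- Dimension count: `j` linear constraints on the `k`-dimensional parameter space, with `j < k`.
    obtain ⟨c, hc, hc0⟩ : ∃ c : Fin k → ℂ, F c ∈ W ∧ c ≠ 0 := by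
      have := LinearMap.ker_ne_bot_of_finrank_lt (f := (Λ : H →ₗ[ℂ] (Fin j → ℂ)) ∘ₗ F)
        (by simp; omega)
      obtain ⟨c, hc, hc0⟩ := Submodule.exists_mem_ne_zero_of_ne_bot this
      exact ⟨c, hc, hc0⟩
    set ι : W →L[ℂ] H := W.subtypeL with hι
    set K' : W →L[ℂ] W := ι.adjoint ∘L K ∘L ι with hK'
    have hinner : ∀ a b : W, inner ℂ a (K' b) = inner ℂ (a : H) (K b) := by
      intro a b
      rw [hK', ContinuousLinearMap.comp_apply, ContinuousLinearMap.adjoint_inner_right]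
      rfl
    have hshift : ∀ (E' : ℝ) (a b : W), inner ℂ a (shiftedOperator (R ∘L ι) K' E' b)
        = inner ℂ (a : H) (shiftedOperator R K E' b) := by
      intro E' a b
      rw [inner_shiftedOperator, inner_shiftedOperator, hinner]
      rfl
    obtain ⟨E', w, hE', hw1, hw2⟩ := exists_ground_state (R ∘L ι)
      (fun a b h => Subtype.ext (hR h)) (fun a => hR1 _) K'
      (fun a b => by
        rw [← inner_conj_symm, hinner, hinner, ← hsymm, inner_conj_symm])
      (by
        rintro u ⟨C, hC⟩
        obtain ⟨φ, y, hφ, hy⟩ := hK (fun n => (u n : H)) ⟨C, hC⟩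
        exact ⟨φ, ι.adjoint y, hφ, (ι.adjoint.continuous.tendsto y).comp hy⟩)
      ⟨⟨F c, hc⟩, by
        have := hF c hc0
        rw [energy, hinner]
        exact this⟩
    have horth : ∀ i, inner ℂ (R (f i)) (R (w : H)) = 0 := (hWmem w).1 w.2
    -- So far the equation holds only when tested on `W`. On each earlier `f i` it holds by symmetry
    -- and the eigenvalue equation of `f i`; replacing `E i` by `E'` changes nothing because `R w`
    -- is orthogonal to `R (f i)`. These vectors together with `W` span `H`.
    have hzero : shiftedOperator R K E' (w : H) = 0 := by
      refine ext_inner_left ℂ fun g => ?_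
      rw [inner_zero_right]
      set s : H := ∑ i, (inner ℂ (R (f i)) (R g)) • f i with hs
      have hgs : g - s ∈ W := by
        rw [hWmem]
        intro i
        rw [map_sub, inner_sub_right, hs, map_sum]
        simp only [map_smul]
        rw [hf.inner_right_fintype, sub_self]
      have h1 : inner ℂ (g - s) (shiftedOperator R K E' (w : H)) = 0 := by
        rw [← hshift E' ⟨g - s, hgs⟩ w, hw2, inner_zero_right]
      have h2 : ∀ i, inner ℂ (f i) (shiftedOperator R K E' (w : H)) = 0 := by
        intro i
        have h3 : inner ℂ (f i) (shiftedOperator R K (E i) (w : H)) = 0 := by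
          rw [← shiftedOperator_symm R K _ hsymm, (hEf i).2, inner_zero_left]
        rw [inner_shiftedOperator, horth i] at h3 ⊢
        simpa using h3
      have h4 : inner ℂ s (shiftedOperator R K E' (w : H)) = 0 := by
        rw [hs, sum_inner]
        exact Finset.sum_eq_zero fun i _ => by rw [inner_smul_left, h2 i, mul_zero]
      rw [← sub_add_cancel g s, inner_add_left, h1, h4, add_zero]
    refine ⟨Fin.snoc E E', Fin.snoc f (w : H), ?_, ?_⟩
    · constructor
      · intro i
        refine Fin.lastCases ?_ (fun i => ?_) i
        · simpa only [Fin.snoc_last] using! hw1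
        · simpa using hf.1 i
      · intro a b
        refine Fin.lastCases ?_ (fun a => ?_) a <;> refine Fin.lastCases ?_ (fun b => ?_) b
        · simp
        · intro _
          simp only [Fin.snoc_last, Fin.snoc_castSucc]
          rw [← inner_conj_symm, horth, map_zero]
        · intro _
          simp only [Fin.snoc_last, Fin.snoc_castSucc]
          exact horth a
        · intro hab
          simp only [Fin.snoc_castSucc]
          exact hf.2 (fun h => hab (by rw [h]))
    · intro i
      refine Fin.lastCases ?_ (fun i => ?_) i
      · simpa using ⟨hE', hzero⟩
      · simpa using hEf i

end Variational

namespace ManyBoundStates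

/-! ### Reduction of the Schrödinger form to bounded operators -/

section Reduction

variable {d : ℕ}

/-- Since `T` is only a.e. measurable, passing from `η` to `ξ` with `η = 2πξ` requires preimages of
null sets to be null. -/
theorem quasiMeasurePreserving_dilation :
    Measure.QuasiMeasurePreserving (fun ξ : E d => (2 * Real.pi) • ξ) volume volume := by
  refine ⟨by fun_prop, ?_⟩
  rw [Measure.map_addHaar_smul _ (by positivity)]
  exact Measure.smul_absolutelyContinuous

theorem aemeasurable_dilation {T : E d → ℝ≥0} (hT : AEMeasurable T volume) :
    AEMeasurable (fun ξ => (T ((2 * Real.pi) • ξ) : ℝ)) volume :=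
  (hT.comp_quasiMeasurePreserving quasiMeasurePreserving_dilation).coe_nnreal_real

theorem fourier_fourierMultiplier {m : E d → ℂ} (f : (fourierMultiplier m).domain) :
    (𝓕 (fourierMultiplier m f) : L2 d) =ᵐ[volume] freqMul m f := by
  have h : fourierMultiplier m f = (𝓕⁻ (MemLp.toLp (freqMul m f.1) f.2 : L2 d) : L2 d) := rfl
  rw [h, FourierTransform.fourier_fourierInv_eq]
  exact MemLp.coeFn_toLp _

theorem fourier_injective {f g : L2 d} (h : (𝓕 f : L2 d) = 𝓕 g) : f = g :=
  (Lp.fourierTransformₗᵢ (E d) ℂ).injective h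

theorem memLp_invSqrt {T : E d → ℝ≥0} (hT : AEMeasurable T volume) (f : L2 d) :
    f ∈ (invSqrtKinetic T).domain := by
  refine MemLp.of_le (Lp.memLp (𝓕 f : L2 d)) ?_ (ae_of_all _ fun ξ => ?_)
  · have := aemeasurable_dilation hT
    refine AEStronglyMeasurable.mul ?_ (Lp.aestronglyMeasurable _)
    exact (Complex.measurable_ofReal.comp_aemeasurable
      (this.add_const 1).sqrt.inv).aestronglyMeasurable
  · rw [freqMul, norm_mul, Complex.norm_real, Real.norm_eq_abs, abs_of_nonneg (by positivity)]
    refine mul_le_of_le_one_left (norm_nonneg _) (inv_le_one_of_one_le₀ ?_)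
    rw [Real.one_le_sqrt]
    linarith [(NNReal.coe_nonneg (T ((2 * Real.pi) • ξ)))]

theorem fourier_invSqrtKinetic {T : E d → ℝ≥0} (f : (invSqrtKinetic T).domain) :
    (𝓕 (invSqrtKinetic T f) : L2 d) =ᵐ[volume] fun ξ =>
      (((Real.sqrt ((T ((2 * Real.pi) • ξ) : ℝ) + 1))⁻¹ : ℝ) : ℂ) * (𝓕 (f : L2 d) : L2 d) ξ :=
  fourier_fourierMultiplier f

theorem fourier_sqrtKinetic {T : E d → ℝ≥0} (f : formDomain T) :
    (𝓕 (sqrtKinetic T f) : L2 d) =ᵐ[volume] fun ξ =>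
      ((Real.sqrt (T ((2 * Real.pi) • ξ)) : ℝ) : ℂ) * (𝓕 (f : L2 d) : L2 d) ξ :=
  fourier_fourierMultiplier f

/-- `(T(p) + 1)^{-1/2}` as a bounded operator. -/
noncomputable def resolventRoot (T : E d → ℝ≥0) (hT : AEMeasurable T volume) : L2 d →L[ℂ] L2 d :=
  LinearMap.mkContinuous
    ((invSqrtKinetic T).toFun ∘ₗ
      LinearMap.codRestrict (invSqrtKinetic T).domain LinearMap.id (memLp_invSqrt hT)) 1
    fun f => by
      have h : ‖(𝓕 (invSqrtKinetic T ⟨f, memLp_invSqrt hT f⟩) : L2 d)‖ ≤ ‖(𝓕 f : L2 d)‖ := by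
        refine Lp.norm_le_norm_of_ae_le ?_
        filter_upwards [fourier_invSqrtKinetic (T := T) ⟨f, memLp_invSqrt hT f⟩] with ξ hξ
        rw [hξ, norm_mul, Complex.norm_real, Real.norm_eq_abs, abs_of_nonneg (by positivity)]
        refine mul_le_of_le_one_left (norm_nonneg _) (inv_le_one_of_one_le₀ ?_)
        rw [Real.one_le_sqrt]
        linarith [(NNReal.coe_nonneg (T ((2 * Real.pi) • ξ)))]
      rw [Lp.norm_fourier_eq, Lp.norm_fourier_eq] at h
      rw [one_mul]
      exact h

variable {T : E d → ℝ≥0} (hT : AEMeasurable T volume)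

theorem norm_resolventRoot_le (f : L2 d) : ‖resolventRoot T hT f‖ ≤ ‖f‖ := by
  simpa using (resolventRoot T hT).le_of_opNorm_le (LinearMap.mkContinuous_norm_le _ zero_le_one _) f

theorem fourier_resolventRoot (f : L2 d) :
    (𝓕 (resolventRoot T hT f) : L2 d) =ᵐ[volume] fun ξ =>
      (((Real.sqrt ((T ((2 * Real.pi) • ξ) : ℝ) + 1))⁻¹ : ℝ) : ℂ) * (𝓕 f : L2 d) ξ :=
  fourier_invSqrtKinetic (T := T) ⟨f, memLp_invSqrt hT f⟩

theorem resolventRoot_injective : Function.Injective (resolventRoot T hT) := by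
  rw [injective_iff_map_eq_zero]
  intro f hf
  have h := fourier_resolventRoot hT f
  apply fourier_injective
  have h0 : (𝓕 (0 : L2 d) : L2 d) = 0 := (Lp.fourierTransformₗᵢ (E d) ℂ).map_zero
  rw [hf, h0] at h
  rw [h0, Lp.eq_zero_iff_ae_eq_zero]
  filter_upwards [h, Lp.coeFn_zero ℂ 2 (volume : Measure (E d))] with ξ h1 h2
  rw [h2] at h1
  have h3 : (((Real.sqrt ((T ((2 * Real.pi) • ξ) : ℝ) + 1))⁻¹ : ℝ) : ℂ) ≠ 0 := by
    rw [Complex.ofReal_ne_zero]; positivity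
  exact (mul_eq_zero.1 h1.symm).resolve_left h3

theorem resolventRoot_mem (f : L2 d) : resolventRoot T hT f ∈ formDomain T := by
  refine MemLp.of_le (Lp.memLp (𝓕 f : L2 d)) ?_ ?_
  · have := aemeasurable_dilation hT
    refine AEStronglyMeasurable.mul ?_ (Lp.aestronglyMeasurable _)
    exact (Complex.measurable_ofReal.comp_aemeasurable this.sqrt).aestronglyMeasurable
  · filter_upwards [fourier_resolventRoot hT f] with ξ hξ
    rw [freqMul, hξ, ← mul_assoc, norm_mul, ← Complex.ofReal_mul, Complex.norm_real,
      Real.norm_eq_abs, abs_of_nonneg (by positivity)]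
    refine mul_le_of_le_one_left (norm_nonneg _) ?_
    rw [mul_inv_le_iff₀ (by positivity), one_mul]
    exact Real.sqrt_le_sqrt (by linarith)

/-- The preimage has Fourier transform `√(T+1) φ̂`, square integrable because `√(T+1) ≤ √T + 1`.
With `resolventRoot_mem`, the form domain is exactly the range of `R`. -/
theorem exists_resolventRoot_eq (φ : formDomain T) : ∃ f, resolventRoot T hT f = φ := by
  have hm := aemeasurable_dilation hT
  have hmem : MemLp (fun ξ => ((Real.sqrt ((T ((2 * Real.pi) • ξ) : ℝ) + 1) : ℝ) : ℂ)
      * (𝓕 (φ : L2 d) : L2 d) ξ) 2 volume := by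
    have h1 : MemLp (freqMul (fun η => ((Real.sqrt (T η) : ℝ) : ℂ)) (φ : L2 d)) 2 volume := φ.2
    refine MemLp.of_le (h1.norm.add (Lp.memLp (𝓕 (φ : L2 d) : L2 d)).norm) ?_
      (ae_of_all _ fun ξ => ?_)
    · refine AEStronglyMeasurable.mul ?_ (Lp.aestronglyMeasurable _)
      exact (Complex.measurable_ofReal.comp_aemeasurable
        (hm.add_const 1).sqrt).aestronglyMeasurable
    · simp only [Pi.add_apply, freqMul, norm_mul, Complex.norm_real, Real.norm_eq_abs,
        abs_of_nonneg (Real.sqrt_nonneg _)]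
      rw [abs_of_nonneg (by positivity)]
      have h2 : Real.sqrt ((T ((2 * Real.pi) • ξ) : ℝ) + 1)
          ≤ Real.sqrt (T ((2 * Real.pi) • ξ)) + 1 := by
        rw [Real.sqrt_le_left (by positivity)]
        nlinarith [Real.sq_sqrt (NNReal.coe_nonneg (T ((2 * Real.pi) • ξ))),
          Real.sqrt_nonneg (T ((2 * Real.pi) • ξ) : ℝ)]
      nlinarith [norm_nonneg ((𝓕 (φ : L2 d) : L2 d) ξ)]
  refine ⟨𝓕⁻ (hmem.toLp : L2 d), fourier_injective (Lp.ext ?_)⟩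
  filter_upwards [fourier_resolventRoot hT (𝓕⁻ (hmem.toLp : L2 d)), hmem.coeFn_toLp] with ξ h1 h2
  rw [h1, FourierTransform.fourier_fourierInv_eq, h2, ← mul_assoc, ← Complex.ofReal_mul,
    inv_mul_cancel₀ (by positivity), Complex.ofReal_one, one_mul]

/-- On the Fourier side this is `T/(T+1) = 1 - 1/(T+1)`. -/
theorem inner_sqrtKinetic_resolventRoot (f g : L2 d) :
    inner ℂ (sqrtKinetic T ⟨_, resolventRoot_mem hT f⟩) (sqrtKinetic T ⟨_, resolventRoot_mem hT g⟩)
      = inner ℂ f g - inner ℂ (resolventRoot T hT f) (resolventRoot T hT g) := by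
  rw [eq_sub_iff_add_eq, ← Lp.inner_fourier_eq, ← Lp.inner_fourier_eq (resolventRoot T hT f),
    ← Lp.inner_fourier_eq f, L2.inner_def, L2.inner_def, L2.inner_def,
    ← integral_add (L2.integrable_inner _ _) (L2.integrable_inner _ _)]
  refine integral_congr_ae ?_
  filter_upwards [fourier_sqrtKinetic (T := T) ⟨_, resolventRoot_mem hT f⟩,
    fourier_sqrtKinetic (T := T) ⟨_, resolventRoot_mem hT g⟩, fourier_resolventRoot hT f,
    fourier_resolventRoot hT g] with ξ h1 h2 h3 h4
  simp only [h1, h2, h3, h4, RCLike.inner_apply, map_mul, Complex.conj_ofReal]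
  have hpos : (0 : ℝ) < (T ((2 * Real.pi) • ξ) : ℝ) + 1 := by positivity
  have e1 : (((Real.sqrt (T ((2 * Real.pi) • ξ)) : ℝ) : ℂ)) ^ 2 = ((T ((2 * Real.pi) • ξ) : ℝ) : ℂ) := by
    rw [← Complex.ofReal_pow, Real.sq_sqrt (NNReal.coe_nonneg (T ((2 * Real.pi) • ξ)))]
  have e2 : ((((Real.sqrt ((T ((2 * Real.pi) • ξ) : ℝ) + 1))⁻¹ : ℝ) : ℂ)) ^ 2
      = (((T ((2 * Real.pi) • ξ) : ℝ) : ℂ) + 1)⁻¹ := by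
    rw [← Complex.ofReal_pow, inv_pow, Real.sq_sqrt hpos.le]; push_cast; rfl
  have e3 : (((T ((2 * Real.pi) • ξ) : ℝ) : ℂ) + 1) ≠ 0 := by exact_mod_cast hpos.ne'
  set a := (((Real.sqrt (T ((2 * Real.pi) • ξ)) : ℝ) : ℂ))
  set b := ((((Real.sqrt ((T ((2 * Real.pi) • ξ) : ℝ) + 1))⁻¹ : ℝ) : ℂ))
  set x := (𝓕 f : L2 d) ξ
  set y := (𝓕 g : L2 d) ξ
  calc a * (b * y) * (a * (b * conj x)) + b * y * (b * conj x)
      = (a ^ 2 + 1) * b ^ 2 * (y * conj x) := by ring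
    _ = _ := by rw [e1, e2, mul_inv_cancel₀ e3, one_mul]

/-! ### Compactness of the signed potential and the eigenvalue criterion -/

variable {V : E d → ℝ}

/-- The product of a square root of `|V|` (up to sign) with `(T(p) + 1)^{-1/2}`. -/
noncomputable def rootMul (s : E d → ℝ)
    (hs : ∀ f : L2 d, MemLp (fun x => (s x : ℂ) * resolventRoot T hT f x) 2 volume) :
    L2 d →ₗ[ℂ] L2 d where
  toFun f := (hs f).toLp
  map_add' f g := by
    rw [← MemLp.toLp_add]
    refine MemLp.toLp_congr _ _ ?_
    rw [map_add]
    filter_upwards [Lp.coeFn_add (resolventRoot T hT f) (resolventRoot T hT g)] with x hx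
    simp only [hx, Pi.add_apply, mul_add]
  map_smul' c f := by
    rw [RingHom.id_apply, ← MemLp.toLp_const_smul]
    refine MemLp.toLp_congr _ _ ?_
    rw [map_smul]
    filter_upwards [Lp.coeFn_smul c (resolventRoot T hT f)] with x hx
    simp only [hx, Pi.smul_apply, smul_eq_mul, mul_left_comm]

theorem inner_rootMul {s t : E d → ℝ}
    (hs : ∀ f : L2 d, MemLp (fun x => (s x : ℂ) * resolventRoot T hT f x) 2 volume)
    (ht : ∀ f : L2 d, MemLp (fun x => (t x : ℂ) * resolventRoot T hT f x) 2 volume) (f g : L2 d) :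
    inner ℂ (rootMul hT s hs f) (rootMul hT t ht g)
      = ∫ x, ((s x * t x : ℝ) : ℂ)
        * (conj (resolventRoot T hT f x) * resolventRoot T hT g x) := by
  rw [L2.inner_def]
  refine integral_congr_ae ?_
  filter_upwards [(hs f).coeFn_toLp, (ht g).coeFn_toLp] with x h1 h2
  change inner ℂ ((hs f).toLp _ x) ((ht g).toLp _ x) = _
  rw [h1, h2, RCLike.inner_apply, map_mul, Complex.conj_ofReal]
  push_cast
  ring

/-- The operator `(T(p)+1)^{-1/2} V (T(p)+1)^{-1/2}` is compact. -/
theorem exists_compact_potential (hV : AEMeasurable V volume) (hcomp : RelativelyFormCompact T V) :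
    ∃ K : L2 d →L[ℂ] L2 d, SeqCompactOperator K ∧ ∀ f g, inner ℂ f (K g) =
      ∫ x, (V x : ℂ) * (conj (resolventRoot T hT f x) * resolventRoot T hT g x) := by
  obtain ⟨h1, K, hK, hKe⟩ := hcomp
  have hKe' : ∀ f g : L2 d, inner ℂ f (K g) = ∫ x, ((|V x| : ℝ) : ℂ)
      * (conj (resolventRoot T hT f x) * resolventRoot T hT g x) :=
    fun f g => hKe ⟨f, memLp_invSqrt hT f⟩ ⟨g, memLp_invSqrt hT g⟩
  set s : E d → ℝ := fun x => Real.sqrt |V x| with hsdef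
  set t : E d → ℝ := fun x => V x / Real.sqrt |V x| with htdef
  -- `t` is the signed square root of `|V|`; where `V = 0`, division by zero gives the right value
  -- `0`.
  have hst : ∀ x, s x * t x = V x := by
    intro x
    by_cases hx : V x = 0
    · simp [hsdef, htdef, hx]
    · have : Real.sqrt |V x| ≠ 0 := by positivity
      simp only [hsdef, htdef]; field_simp
  have htabs : ∀ x, |t x| = s x := by
    intro x
    simp only [hsdef, htdef]
    rw [abs_div, abs_of_nonneg (Real.sqrt_nonneg _), Real.div_sqrt]
  have hss : ∀ x, s x * s x = |V x| := fun x => Real.mul_self_sqrt (abs_nonneg _)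
  have htt : ∀ x, t x * t x = |V x| := fun x => by rw [← abs_mul_abs_self, htabs, hss]
  have hs : ∀ f : L2 d, MemLp (fun x => (s x : ℂ) * resolventRoot T hT f x) 2 volume :=
    fun f => h1 _ (resolventRoot_mem hT f)
  have ht : ∀ f : L2 d, MemLp (fun x => (t x : ℂ) * resolventRoot T hT f x) 2 volume := by
    intro f
    refine MemLp.of_le (hs f) ?_ (ae_of_all _ fun x => ?_)
    · refine AEStronglyMeasurable.mul ?_ (Lp.aestronglyMeasurable _)
      refine (Complex.measurable_ofReal.comp_aemeasurable
        (hV.div (?_ : AEMeasurable s volume))).aestronglyMeasurable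
      exact hV.norm.sqrt
    · simp only [norm_mul, Complex.norm_real, Real.norm_eq_abs, htabs]
      exact mul_le_mul_of_nonneg_right (le_abs_self _) (norm_nonneg _)
  -- The hypothesis concerns `|V|`, while `V` is needed. For either root `r` of `|V|`, `‖r R f‖² =
  -- ⟨f, K f⟩`, so compactness of `K` passes to `f ↦ r R f`, and the operator for `V` factors as `(s
  -- R)* (t R)`.
  have hsq : ∀ (r : E d → ℝ) (hr : ∀ f : L2 d,
      MemLp (fun x => (r x : ℂ) * resolventRoot T hT f x) 2 volume),
      (∀ x, r x * r x = |V x|) → ∀ f, ‖rootMul hT r hr f‖ ^ 2 ≤ ‖f‖ * ‖K f‖ := by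
    intro r hr hrr f
    have h2 : inner ℂ (rootMul hT r hr f) (rootMul hT r hr f) = inner ℂ f (K f) := by
      rw [inner_rootMul, hKe']; simp only [hrr]
    rw [inner_self_eq_norm_sq_to_K] at h2
    have h3 : ‖((‖rootMul hT r hr f‖ : ℂ)) ^ 2‖ = ‖inner ℂ f (K f)‖ := congrArg norm h2
    rw [norm_pow, Complex.norm_real, norm_norm] at h3
    rw [h3]
    exact norm_inner_le_norm _ _
  have hbound : ∀ (r : E d → ℝ) (hr : ∀ f : L2 d,
      MemLp (fun x => (r x : ℂ) * resolventRoot T hT f x) 2 volume),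
      (∀ x, r x * r x = |V x|) → ∀ f, ‖rootMul hT r hr f‖ ≤ (‖K‖ + 1) * ‖f‖ := by
    intro r hr hrr f
    refine le_of_sq_le_sq ?_ (by positivity)
    refine (hsq r hr hrr f).trans ?_
    have h2 := K.le_opNorm f
    have h3 : 0 ≤ ‖K‖ := norm_nonneg _
    calc ‖f‖ * ‖K f‖ ≤ ‖f‖ * (‖K‖ * ‖f‖) := by gcongr
      _ = ‖K‖ * ‖f‖ ^ 2 := by ring
      _ ≤ (‖K‖ + 1) ^ 2 * ‖f‖ ^ 2 := by gcongr; nlinarith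
      _ = _ := by ring
  set Bs : L2 d →L[ℂ] L2 d := (rootMul hT s hs).mkContinuous _ (hbound s hs hss) with hBs
  set Bt : L2 d →L[ℂ] L2 d := (rootMul hT t ht).mkContinuous _ (hbound t ht htt) with hBt
  refine ⟨Bs.adjoint ∘L Bt, ?_, fun f g => ?_⟩
  · rintro u ⟨C, hC⟩
    obtain ⟨φ, y, hφ, hy⟩ := hK.seqCompactOperator u ⟨C, hC⟩
    have hcauchy : CauchySeq fun n => Bt (u (φ n)) := by
      rw [Metric.cauchySeq_iff']
      intro ε hε
      have hC0 : 0 ≤ C := (norm_nonneg _).trans (hC 0)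
      obtain ⟨N, hN⟩ := Metric.cauchySeq_iff'.1 hy.cauchySeq (ε ^ 2 / (2 * C + 1)) (by positivity)
      refine ⟨N, fun n hn => ?_⟩
      have h2 := hN n hn
      rw [dist_eq_norm, ← map_sub] at h2 ⊢
      refine lt_of_pow_lt_pow_left₀ 2 hε.le ?_
      refine (hsq t ht htt _).trans_lt ?_
      rw [lt_div_iff₀ (by positivity)] at h2
      have h3 : ‖u (φ n) - u (φ N)‖ ≤ 2 * C := by
        refine (norm_sub_le _ _).trans ?_
        linarith [hC (φ n), hC (φ N)]
      calc _ ≤ (2 * C + 1) * ‖K (u (φ n) - u (φ N))‖ := by gcongr; linarith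
        _ < _ := by linarith
    obtain ⟨z, hz⟩ := cauchySeq_tendsto_of_complete hcauchy
    exact ⟨φ, Bs.adjoint z, hφ, (Bs.adjoint.continuous.tendsto z).comp hz⟩
  · rw [ContinuousLinearMap.comp_apply, ContinuousLinearMap.adjoint_inner_right]
    change inner ℂ (rootMul hT s hs f) (rootMul hT t ht g) = _
    rw [inner_rootMul]
    simp only [hst]

/-- A `k`-dimensional family in the form domain on which the form is negative definite yields `k`
negative eigenvalues. -/
theorem hasAtLeastNegativeEigenvalues_of_negative (hT : AEMeasurable T volume)
    (hV : AEMeasurable V volume) (hcomp : RelativelyFormCompact T V) {k : ℕ}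
    (F : (Fin k → ℂ) →ₗ[ℂ] formDomain T)
    (hF : ∀ c, c ≠ 0 → (schrodingerForm T V (F c) (F c)).re < 0) :
    HasAtLeastNegativeEigenvalues T V k := by
  obtain ⟨K, hK, hKe⟩ := exists_compact_potential hT hV hcomp
  set R := resolventRoot T hT with hR
  have hform : ∀ f g : L2 d, schrodingerForm T V ⟨R f, resolventRoot_mem hT f⟩
      ⟨R g, resolventRoot_mem hT g⟩ = inner ℂ f g - inner ℂ (R f) (R g) + inner ℂ f (K g) := by
    intro f g
    rw [schrodingerForm, inner_sqrtKinetic_resolventRoot, hKe]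
  set e : L2 d ≃ₗ[ℂ] formDomain T := LinearEquiv.ofBijective
    (LinearMap.codRestrict (formDomain T) (R : L2 d →ₗ[ℂ] L2 d) (resolventRoot_mem hT))
    ⟨fun a b h => resolventRoot_injective hT (congrArg Subtype.val h),
      fun φ => (exists_resolventRoot_eq hT φ).imp fun f hf => Subtype.ext hf⟩ with he
  have hen : ∀ f, e f = ⟨R f, resolventRoot_mem hT f⟩ := fun f => rfl
  have hsymm : ∀ f g, inner ℂ (K f) g = inner ℂ f (K g) := by
    intro f g
    rw [← inner_conj_symm, hKe, hKe, ← integral_conj]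
    congr 1
    ext x
    simp only [map_mul, Complex.conj_conj, Complex.conj_ofReal]
    ring
  obtain ⟨μ, f, hf, hμ⟩ := exists_orthonormal_eigenvectors R (resolventRoot_injective hT)
    (norm_resolventRoot_le hT) K hsymm hK (e.symm.toLinearMap ∘ₗ F)
    (fun c hc => by
      have h := hF c hc
      obtain ⟨g, hg⟩ := e.surjective (F c)
      have h2 : (e.symm.toLinearMap ∘ₗ F) c = g := by simp [← hg]
      rw [h2]
      rw [← hg, hen, hform, inner_self_eq_norm_sq_to_K, inner_self_eq_norm_sq_to_K] at h
      simp only [Complex.add_re, Complex.sub_re, Complex.coe_algebraMap, ← Complex.ofReal_pow,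
        Complex.ofReal_re] at h
      exact h) k le_rfl
  -- The eigenvectors in `L²` are `R (f i)`, orthonormal by construction; hence multiplicities are
  -- counted correctly.
  refine ⟨μ, fun i => R (f i), hf.linearIndependent, fun j => ⟨(hμ j).1, ?_⟩⟩
  refine ⟨⟨R (f j), resolventRoot_mem hT _⟩, rfl, fun φ => ?_⟩
  obtain ⟨g, rfl⟩ := e.surjective φ
  have h := congrArg (inner ℂ g) (hμ j).2
  rw [inner_shiftedOperator, inner_zero_right] at h
  rw [hen, hform, inner_smul_right]
  push_cast at h
  linear_combination h

end Reduction

/-! ### Zeros of trigonometric polynomials -/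

section TrigPolynomial

/-- The character `t ↦ exp (i a t)` of `ℝ`. -/
noncomputable def expHom (a : ℝ) : Multiplicative ℝ →* ℂ where
  toFun t := Complex.exp (Complex.I * (a * t.toAdd : ℝ))
  map_one' := by simp
  map_mul' s t := by
    rw [← Complex.exp_add]
    congr 1
    simp only [toAdd_mul]
    push_cast
    ring

theorem expHom_injective : Function.Injective expHom := by
  intro a b hab
  by_contra hne
  have hsub : a - b ≠ 0 := sub_ne_zero.2 hne
  -- At `t = 1/(a - b)` the phases differ by `1`, which is not an integer multiple of `2π`.
  have h := DFunLike.congr_fun hab (Multiplicative.ofAdd ((a - b)⁻¹))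
  simp only [expHom, MonoidHom.coe_mk, OneHom.coe_mk, toAdd_ofAdd] at h
  rw [Complex.exp_eq_exp_iff_exists_int] at h
  obtain ⟨n, hn⟩ := h
  have h1 : ((a * (a - b)⁻¹ : ℝ) : ℂ) = ((b * (a - b)⁻¹ + n * (2 * Real.pi) : ℝ) : ℂ) := by
    apply mul_left_cancel₀ Complex.I_ne_zero
    rw [hn]
    push_cast
    ring
  have h2 : a * (a - b)⁻¹ - b * (a - b)⁻¹ = n * (2 * Real.pi) := by
    rw [Complex.ofReal_inj.1 h1]; ring
  rw [← sub_mul, mul_inv_cancel₀ hsub] at h2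
  have hpi := Real.pi_gt_three
  rcases lt_trichotomy n 0 with h3 | h3 | h3
  · have : (n : ℝ) < 0 := by exact_mod_cast h3
    nlinarith
  · subst h3; simp at h2
  · have : (1 : ℝ) ≤ n := by exact_mod_cast h3
    nlinarith

variable {k : ℕ}

/-- A real analytic function on the line is identically zero or has a null zero set; the former is
excluded by Dedekind's independence of distinct characters. -/
theorem expSum_ne_zero_ae {a : Fin k → ℝ} (ha : Function.Injective a) {c : Fin k → ℂ}
    (hc : c ≠ 0) :
    ∀ᵐ t : ℝ, ∑ l, c l * Complex.exp (Complex.I * (a l * t : ℝ)) ≠ 0 := by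
  set h : ℝ → ℂ := fun t => ∑ l, c l * Complex.exp (Complex.I * (a l * t : ℝ)) with hdef
  have han : AnalyticOnNhd ℝ h Set.univ := by
    intro t _
    refine Finset.univ.analyticAt_fun_sum fun l _ => analyticAt_const.mul ?_
    have h1 : AnalyticAt ℝ (fun z : ℂ => Complex.exp (Complex.I * z)) ((a l * t : ℝ) : ℂ) :=
      ((analyticAt_const.mul analyticAt_id).cexp : AnalyticAt ℂ _ _).restrictScalars
    have h2 : AnalyticAt ℝ (fun s : ℝ => ((a l * s : ℝ) : ℂ)) t :=
      (Complex.ofRealCLM.analyticAt _).comp (analyticAt_const.mul analyticAt_id)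
    exact AnalyticAt.comp (f := fun s : ℝ => ((a l * s : ℝ) : ℂ)) h1 h2
  rcases han.eqOn_zero_or_eventually_ne_zero_of_preconnected isPreconnected_univ with h0 | h0
  · exfalso
    have hli := (linearIndependent_monoidHom (Multiplicative ℝ) ℂ).comp (fun l => expHom (a l))
      (expHom_injective.comp ha)
    refine hc (funext fun l => Fintype.linearIndependent_iff.1 hli c ?_ l)
    ext t
    have := h0 (Set.mem_univ t.toAdd)
    simpa [hdef, expHom] using this
  · have := ae_restrict_le_codiscreteWithin (μ := (volume : Measure ℝ)) MeasurableSet.univ h0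
    rwa [Measure.restrict_univ] at this

/-- The trigonometric polynomial `∑ c_l exp (i ω_l · x)`. -/
noncomputable def trigPoly {d : ℕ} (ω : Fin k → E d) (c : Fin k → ℂ) (x : E d) : ℂ :=
  ∑ l, c l * Complex.exp (Complex.I * (inner ℝ (ω l) x : ℝ))

theorem continuous_trigPoly {d : ℕ} (ω : Fin k → E d) (c : Fin k → ℂ) :
    Continuous (trigPoly ω c) := by
  unfold trigPoly
  fun_prop

/-- Reduction to one dimension: along a direction `v` that separates the `ω l`, each line
restriction is an exponential sum with distinct frequencies and nonzero coefficient vector. -/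
theorem trigPoly_ne_zero_ae {d : ℕ} {ω : Fin k → E d} (hω : Function.Injective ω)
    {c : Fin k → ℂ} (hc : c ≠ 0) : ∀ᵐ x, trigPoly ω c x ≠ 0 := by
  obtain ⟨f, hf⟩ := Module.exists_dual_forall_apply_ne_zero (K := ℝ)
    (fun p : {p : Fin k × Fin k // p.1 ≠ p.2} => ω p.1.1 - ω p.1.2)
    (fun p => sub_ne_zero.2 (hω.ne p.2))
  set v : E d := (InnerProductSpace.toDual ℝ (E d)).symm (LinearMap.toContinuousLinearMap f) with hv
  have hvf : ∀ y, inner ℝ y v = f y := by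
    intro y
    rw [real_inner_comm, hv, InnerProductSpace.toDual_symm_apply]
    rfl
  have hinj : Function.Injective fun l => inner ℝ (ω l) v := by
    intro l m hlm
    by_contra hne
    refine hf ⟨(l, m), hne⟩ ?_
    simp only [hvf] at hlm
    rw [map_sub, hlm, sub_self]
  have hslice : ∀ x : E d, ∀ᵐ t : ℝ, trigPoly ω c (x + t • v) ≠ 0 := by
    intro x
    have hc' : (fun l => c l * Complex.exp (Complex.I * (inner ℝ (ω l) x : ℝ))) ≠ 0 := by
      intro h
      refine hc (funext fun l => ?_)
      have := congrFun h l
      simpa [Complex.exp_ne_zero] using this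
    filter_upwards [expSum_ne_zero_ae hinj hc'] with t ht
    convert ht using 1
    refine Finset.sum_congr rfl fun l _ => ?_
    rw [mul_assoc, ← Complex.exp_add, inner_add_right, inner_smul_right]
    congr 2
    push_cast
    ring
  have hmeas : MeasurableSet {p : E d × ℝ | trigPoly ω c (p.1 + p.2 • v) ≠ 0} := by
    refine (IsOpen.measurableSet ?_)
    refine isOpen_ne_fun ((continuous_trigPoly ω c).comp (by fun_prop)) continuous_const
  -- Fubini gives a single `t` for which `p_c (x + t v) ≠ 0` for almost every `x`; translation
  -- invariance removes the shift.
  obtain ⟨t, ht⟩ := ((Measure.ae_ae_comm (μ := (volume : Measure (E d))) (ν := (volume : Measure ℝ))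
    hmeas).1 (ae_of_all _ hslice)).exists
  have := (measurePreserving_add_right (volume : Measure (E d))
    (-(t • v))).quasiMeasurePreserving.ae ht
  filter_upwards [this] with x hx
  simpa using hx

end TrigPolynomial

/-! ### Trial functions concentrating at a thick zero -/

section TrialFunctions

open Topology SchwartzMap

variable {d : ℕ}

theorem continuous_fourierInv {g : E d → ℂ} (hg : Integrable g volume) :
    Continuous (𝓕⁻ g : E d → ℂ) :=
  VectorFourier.fourierIntegral_continuous Real.continuous_fourierChar
    (by simp only [LinearMap.neg_apply, innerₗ_apply_apply]; fun_prop) hg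

/-- Fubini, together with the symmetry of the kernel in its two variables. -/
theorem integral_fourierInv_smul {f g : E d → ℂ} (hf : Integrable f volume)
    (hg : Integrable g volume) :
    ∫ x, (𝓕⁻ f : E d → ℂ) x • g x = ∫ x, f x • (𝓕⁻ g : E d → ℂ) x := by
  have h := VectorFourier.integral_fourierIntegral_smul_eq_flip (μ := volume) (ν := volume)
    (L := -innerₗ (E d)) Real.continuous_fourierChar
    (by simp only [LinearMap.neg_apply, innerₗ_apply_apply]; fun_prop) hf hg
  have hflip : (-innerₗ (E d)).flip = -innerₗ (E d) := by
    ext x y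
    simp [real_inner_comm]
  rw [hflip] at h
  exact h

/-- On `L¹ ∩ L²`, the inverse Fourier transform on `L²` is given by the integral. -/
theorem fourierInv_toLp_ae_eq {g : E d → ℂ} (hg : Integrable g volume) (hg2 : MemLp g 2 volume) :
    ((𝓕⁻ (hg2.toLp : L2 d) : L2 d) : E d → ℂ) =ᵐ[volume] (𝓕⁻ g : E d → ℂ) := by
  refine ae_eq_of_integral_contDiff_smul_eq ((Lp.memLp _).locallyIntegrable one_le_two)
    (continuous_fourierInv hg).locallyIntegrable ?_
  intro s hs hsc
  have hs₁ : HasCompactSupport (Complex.ofRealCLM ∘ s) := hsc.comp_left rfl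
  have hs₂ : ContDiff ℝ ((⊤ : ℕ∞) : WithTop ℕ∞) (Complex.ofRealCLM ∘ s) := by fun_prop
  set S : 𝓢(E d, ℂ) := hs₁.toSchwartzMap hs₂ with hS
  have hSs : ∀ (x : E d) (z : ℂ), S x • z = s x • z := by
    intro x z
    simp [hS]
  calc ∫ x, s x • (𝓕⁻ (hg2.toLp : L2 d) : L2 d) x
      = Lp.toTemperedDistribution (𝓕⁻ (hg2.toLp : L2 d) : L2 d) S := by
        rw [Lp.toTemperedDistribution_apply]; simp only [hSs]
    _ = Lp.toTemperedDistribution (hg2.toLp : L2 d) (𝓕⁻ S) := by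
        rw [← Lp.fourierInv_toTemperedDistribution_eq, TemperedDistribution.fourierInv_apply]
    _ = ∫ x, (𝓕⁻ (S : E d → ℂ) : E d → ℂ) x • g x := by
        rw [Lp.toTemperedDistribution_apply]
        refine integral_congr_ae ?_
        filter_upwards [hg2.coeFn_toLp] with x hx
        rw [hx, SchwartzMap.fourierInv_coe]
    _ = ∫ x, S x • (𝓕⁻ g : E d → ℂ) x := integral_fourierInv_smul S.integrable hg
    _ = _ := by simp only [hSs]

variable {T : E d → ℝ≥0}

/-- An integrable square-integrable function with finite kinetic energy on the frequency side
defines an element of the form domain. -/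
theorem exists_formDomain_fourierInv {g : E d → ℂ} (hg : Integrable g volume)
    (hg2 : MemLp g 2 volume)
    (hTg : MemLp (fun ξ => ((Real.sqrt (T ((2 * Real.pi) • ξ)) : ℝ) : ℂ) * g ξ) 2 volume) :
    ∃ φ : formDomain T, ((φ : L2 d) : E d → ℂ) =ᵐ[volume] (𝓕⁻ g : E d → ℂ) ∧
      ‖sqrtKinetic T φ‖ ^ 2 = ∫ ξ, (T ((2 * Real.pi) • ξ) : ℝ) * ‖g ξ‖ ^ 2 := by
  have hae : freqMul (fun η => ((Real.sqrt (T η) : ℝ) : ℂ)) (𝓕⁻ (hg2.toLp : L2 d) : L2 d)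
      =ᵐ[volume] fun ξ => ((Real.sqrt (T ((2 * Real.pi) • ξ)) : ℝ) : ℂ) * g ξ := by
    unfold freqMul
    rw [FourierTransform.fourier_fourierInv_eq]
    filter_upwards [hg2.coeFn_toLp] with ξ hξ
    rw [hξ]
  refine ⟨⟨(𝓕⁻ (hg2.toLp : L2 d) : L2 d), (memLp_congr_ae hae).2 hTg⟩,
    fourierInv_toLp_ae_eq hg hg2, ?_⟩
  set φ : formDomain T := ⟨(𝓕⁻ (hg2.toLp : L2 d) : L2 d), (memLp_congr_ae hae).2 hTg⟩
  have h1 : ((‖sqrtKinetic T φ‖ ^ 2 : ℝ) : ℂ)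
      = ((∫ ξ, (T ((2 * Real.pi) • ξ) : ℝ) * ‖g ξ‖ ^ 2 : ℝ) : ℂ) := by
    have h2 := inner_self_eq_norm_sq_to_K (𝕜 := ℂ) (sqrtKinetic T φ)
    rw [← Lp.inner_fourier_eq, L2.inner_def] at h2
    push_cast
    refine Eq.trans h2.symm ?_
    rw [← integral_complex_ofReal]
    refine integral_congr_ae ?_
    filter_upwards [fourier_fourierMultiplier φ, hae] with ξ h3 h4
    have h5 : (𝓕 (sqrtKinetic T φ) : L2 d) ξ
        = ((Real.sqrt (T ((2 * Real.pi) • ξ)) : ℝ) : ℂ) * g ξ := h3.trans h4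
    rw [h5, inner_self_eq_norm_sq_to_K, norm_mul, Complex.norm_real, Real.norm_eq_abs,
      abs_of_nonneg (Real.sqrt_nonneg _)]
    refine (Complex.ofReal_pow _ _).symm.trans ?_
    rw [Algebra.algebraMap_self_apply, mul_pow, Real.sq_sqrt (NNReal.coe_nonneg _)]
  exact_mod_cast h1

/-- The thick zero set condition on the frequency side. -/
theorem ThickZeroSetNear.lintegral_dilation {ω : E d} (h : ThickZeroSetNear T ω) {δ : ℝ}
    (hδ : 0 < δ) :
    ∫⁻ ξ in Metric.ball ((2 * Real.pi)⁻¹ • ω) δ, ((T ((2 * Real.pi) • ξ) : ℝ≥0∞))⁻¹ = ∞ := by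
  have hpi : (0 : ℝ) < 2 * Real.pi := by positivity
  have hemb : MeasurableEmbedding (fun ξ : E d => (2 * Real.pi) • ξ) :=
    (Homeomorph.smulOfNeZero (2 * Real.pi) hpi.ne').measurableEmbedding
  have hpre : (fun ξ : E d => (2 * Real.pi) • ξ) ⁻¹' Metric.ball ω (2 * Real.pi * δ)
      = Metric.ball ((2 * Real.pi)⁻¹ • ω) δ := by
    ext ξ
    have e : (2 * Real.pi) • ξ - ω = (2 * Real.pi) • (ξ - (2 * Real.pi)⁻¹ • ω) := by
      rw [smul_sub, smul_smul, mul_inv_cancel₀ hpi.ne', one_smul]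
    simp only [Set.mem_preimage, Metric.mem_ball, dist_eq_norm]
    rw [e, norm_smul, Real.norm_eq_abs, abs_of_pos hpi, mul_lt_mul_iff_right₀ hpi]
  have h1 := h (2 * Real.pi * δ) (by positivity)
  rw [← hpre]
  have h2 : ∫⁻ η in Metric.ball ω (2 * Real.pi * δ), ((T η : ℝ≥0∞))⁻¹
      ∂(Measure.map (fun ξ : E d => (2 * Real.pi) • ξ) volume)
      = ∫⁻ ξ in (fun ξ : E d => (2 * Real.pi) • ξ) ⁻¹' Metric.ball ω (2 * Real.pi * δ),
        ((T ((2 * Real.pi) • ξ) : ℝ≥0∞))⁻¹ := by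
    rw [hemb.restrict_map, hemb.lintegral_map]
  rw [← h2, Measure.map_addHaar_smul _ hpi.ne', Measure.restrict_smul, lintegral_smul_measure, h1,
    smul_eq_mul, ENNReal.mul_top]
  rw [ENNReal.ofReal_ne_zero_iff]
  positivity

/-- Normalised densities concentrating near a point of a thick zero set with small kinetic
energy. -/
theorem exists_concentrated_density (hT : AEMeasurable T volume) {ω : E d}
    (h : ThickZeroSetNear T ω) {δ : ℝ} (hδ : 0 < δ) :
    ∃ g : E d → ℝ, AEMeasurable g volume ∧ (∀ ξ, 0 ≤ g ξ) ∧ (∃ C, ∀ ξ, g ξ ≤ C) ∧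
      (∀ ξ, ξ ∉ Metric.ball ((2 * Real.pi)⁻¹ • ω) δ → g ξ = 0) ∧ ∫ ξ, g ξ = 1 ∧
      Integrable (fun ξ => (T ((2 * Real.pi) • ξ) : ℝ) * g ξ ^ 2) volume ∧
      ∫ ξ, (T ((2 * Real.pi) • ξ) : ℝ) * g ξ ^ 2 ≤ δ := by
  set B := Metric.ball ((2 * Real.pi)⁻¹ • ω) δ with hB
  set τ : E d → ℝ≥0 := fun ξ => T ((2 * Real.pi) • ξ) with hτ
  have hτm : AEMeasurable τ volume :=
    hT.comp_quasiMeasurePreserving quasiMeasurePreserving_dilation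
  have hBm : MeasurableSet B := Metric.isOpen_ball.measurableSet
  -- Monotone convergence to the divergent integral of `1/τ`. Regularising by `1/(m+1)` keeps each
  -- density bounded, even where `τ` vanishes.
  have hlim : Tendsto (fun m : ℕ => ∫⁻ ξ in B, ((τ ξ : ℝ≥0∞) + ((m : ℝ≥0∞) + 1)⁻¹)⁻¹) atTop
      (𝓝 ∞) := by
    rw [← h.lintegral_dilation hδ]
    refine lintegral_tendsto_of_tendsto_of_monotone (fun m => ?_) (ae_of_all _ fun ξ => ?_)
      (ae_of_all _ fun ξ => ?_)
    · exact ((hτm.coe_nnreal_ennreal.add_const _).inv).restrict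
    · intro m n hmn
      have : (m : ℝ≥0∞) ≤ n := by exact_mod_cast hmn
      simp only
      gcongr
    · refine (tendsto_inv_iff.2 ?_)
      have h1 : Tendsto (fun m : ℕ => ((m : ℝ≥0∞) + 1)⁻¹) atTop (𝓝 0) := by
        have := (ENNReal.tendsto_inv_nat_nhds_zero).comp (tendsto_add_atTop_nat 1)
        simpa [Function.comp_def] using this
      simpa using h1.const_add (τ ξ : ℝ≥0∞)
  obtain ⟨m, hm⟩ := (hlim.eventually (lt_mem_nhds (ENNReal.ofReal_lt_top (r := δ⁻¹)))).exists
  set ε : ℝ := ((m : ℝ) + 1)⁻¹ with hε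
  have hεpos : 0 < ε := by positivity
  set f : E d → ℝ := B.indicator fun ξ => ((τ ξ : ℝ) + ε)⁻¹ with hf
  have hfm : AEMeasurable f volume := (hτm.coe_nnreal_real.add_const ε).inv.indicator hBm
  have hf0 : ∀ ξ, 0 ≤ f ξ := fun ξ => Set.indicator_nonneg (fun _ _ => by positivity) ξ
  have hfC : ∀ ξ, f ξ ≤ ε⁻¹ := by
    intro ξ
    rw [hf]
    by_cases hξ : ξ ∈ B
    · rw [Set.indicator_of_mem hξ]
      exact inv_anti₀ hεpos (by simp)
    · rw [Set.indicator_of_notMem hξ]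
      positivity
  have hTf : ∀ ξ, (τ ξ : ℝ) * f ξ ≤ 1 := by
    intro ξ
    rw [hf]
    by_cases hξ : ξ ∈ B
    · rw [Set.indicator_of_mem hξ, mul_inv_le_iff₀ (by positivity)]
      linarith
    · simp [Set.indicator_of_notMem hξ]
  have hBfin : volume B ≠ ∞ := measure_ball_lt_top.ne
  have hfint : Integrable f volume := by
    have h1 : Integrable (B.indicator fun _ => ε⁻¹) (volume : Measure (E d)) :=
      (integrable_indicator_iff hBm).2 (integrableOn_const hBfin)
    refine h1.mono' hfm.aestronglyMeasurable (ae_of_all _ fun ξ => ?_)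
    rw [Real.norm_eq_abs, abs_of_nonneg (hf0 ξ)]
    exact Set.indicator_le_indicator (inv_anti₀ hεpos (by simp))
  set I := ∫ ξ, f ξ with hI
  have hIlow : δ⁻¹ < I := by
    have h1 : ∫⁻ ξ in B, ((τ ξ : ℝ≥0∞) + ((m : ℝ≥0∞) + 1)⁻¹)⁻¹ = ENNReal.ofReal I := by
      rw [hI, ofReal_integral_eq_lintegral_ofReal hfint (ae_of_all _ hf0),
        ← lintegral_indicator hBm]
      refine lintegral_congr fun ξ => ?_
      rw [hf]
      by_cases hξ : ξ ∈ B
      · rw [Set.indicator_of_mem hξ, Set.indicator_of_mem hξ,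
          ENNReal.ofReal_inv_of_pos (by positivity),
          ENNReal.ofReal_add (by positivity) hεpos.le, hε,
          ENNReal.ofReal_inv_of_pos (by positivity), ENNReal.ofReal_add (by positivity) zero_le_one]
        simp
      · simp [Set.indicator_of_notMem hξ]
    rw [h1] at hm
    exact (ENNReal.ofReal_lt_ofReal_iff_of_nonneg (by positivity)).1 hm
  have hIpos : 0 < I := lt_trans (by positivity) hIlow
  -- Since `τ f ≤ 1`, one factor `f` absorbs `τ`; integrating leaves the energy bound `1/I < δ`.
  have hle : ∀ ξ, (τ ξ : ℝ) * (I⁻¹ * f ξ) ^ 2 ≤ I⁻¹ ^ 2 * f ξ := by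
    intro ξ
    calc (τ ξ : ℝ) * (I⁻¹ * f ξ) ^ 2 = I⁻¹ ^ 2 * (((τ ξ : ℝ) * f ξ) * f ξ) := by ring
      _ ≤ I⁻¹ ^ 2 * (1 * f ξ) := by
        gcongr
        · exact hf0 ξ
        · exact hTf ξ
      _ = _ := by ring
  have hint2 : Integrable (fun ξ => (τ ξ : ℝ) * (I⁻¹ * f ξ) ^ 2) volume := by
    refine (hfint.const_mul (I⁻¹ ^ 2)).mono'
      (hτm.coe_nnreal_real.mul ((hfm.const_mul _).pow_const 2)).aestronglyMeasurable
      (ae_of_all _ fun ξ => ?_)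
    rw [Real.norm_eq_abs, abs_of_nonneg (by positivity)]
    exact hle ξ
  refine ⟨fun ξ => I⁻¹ * f ξ, hfm.const_mul _, fun ξ => mul_nonneg (by positivity) (hf0 ξ),
    ⟨I⁻¹ * ε⁻¹, fun ξ => mul_le_mul_of_nonneg_left (hfC ξ) (by positivity)⟩, fun ξ hξ => ?_, ?_, hint2, ?_⟩
  · simp only [hf, Set.indicator_of_notMem hξ, mul_zero]
  · rw [integral_const_mul, ← hI, inv_mul_cancel₀ hIpos.ne']
  · refine (integral_mono hint2 (hfint.const_mul (I⁻¹ ^ 2)) hle).trans ?_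
    rw [integral_const_mul, ← hI, sq, mul_assoc, inv_mul_cancel₀ hIpos.ne', mul_one]
    exact (inv_lt_of_inv_lt₀ hδ hIlow).le

/-- Elements of the form domain that converge boundedly to the plane wave `exp (i ω · x)` while
their kinetic energy tends to zero. -/
theorem exists_trial_sequence (hT : AEMeasurable T volume) {ω : E d}
    (h : ThickZeroSetNear T ω) :
    ∃ (φ : ℕ → formDomain T) (u : ℕ → E d → ℂ),
      (∀ n, ((φ n : L2 d) : E d → ℂ) =ᵐ[volume] u n) ∧ (∀ n x, ‖u n x‖ ≤ 1) ∧
      (∀ x, Tendsto (fun n => u n x) atTop (𝓝 (Complex.exp (Complex.I * (inner ℝ ω x : ℝ))))) ∧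
      Tendsto (fun n => ‖sqrtKinetic T (φ n)‖) atTop (𝓝 0) := by
  have hδ : ∀ n : ℕ, (0 : ℝ) < 1 / ((n : ℝ) + 1) := fun n => by positivity
  choose g hgm hg0 hgC hgB hg1 hgT hgTle using fun n : ℕ => exists_concentrated_density hT h (hδ n)
  have hgint : ∀ n, Integrable (g n) volume := fun n =>
    Integrable.of_integral_ne_zero (by rw [hg1]; exact one_ne_zero)
  set G : ℕ → E d → ℂ := fun n ξ => (g n ξ : ℂ) with hG
  have hGint : ∀ n, Integrable (G n) volume := fun n => (hgint n).ofReal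
  have hGnorm : ∀ n ξ, ‖G n ξ‖ = g n ξ := fun n ξ => by
    rw [hG, Complex.norm_real, Real.norm_eq_abs, abs_of_nonneg (hg0 n ξ)]
  have hG2 : ∀ n, MemLp (G n) 2 volume := by
    intro n
    obtain ⟨C, hC⟩ := hgC n
    rw [memLp_two_iff_integrable_sq_norm (hGint n).aestronglyMeasurable]
    refine ((hgint n).const_mul C).mono' ((hGint n).aestronglyMeasurable.norm.pow 2)
      (ae_of_all _ fun ξ => ?_)
    rw [hGnorm, Real.norm_eq_abs, abs_of_nonneg (by positivity), sq]
    exact mul_le_mul_of_nonneg_right (hC ξ) (hg0 n ξ)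
  have hTG : ∀ n, MemLp (fun ξ => ((Real.sqrt (T ((2 * Real.pi) • ξ)) : ℝ) : ℂ) * G n ξ) 2
      volume := by
    intro n
    rw [memLp_two_iff_integrable_sq_norm]
    · refine (hgT n).congr (ae_of_all _ fun ξ => ?_)
      simp only
      rw [norm_mul, hGnorm, Complex.norm_real, Real.norm_eq_abs,
        abs_of_nonneg (Real.sqrt_nonneg _), mul_pow, Real.sq_sqrt (NNReal.coe_nonneg _)]
    · exact ((Complex.measurable_ofReal.comp_aemeasurable
        (aemeasurable_dilation hT).sqrt).aestronglyMeasurable).mul (hGint n).aestronglyMeasurable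
  choose φ hφ hφT using fun n => exists_formDomain_fourierInv (hGint n) (hG2 n) (hTG n)
  refine ⟨φ, fun n => (𝓕⁻ (G n) : E d → ℂ), hφ, fun n x => ?_, fun x => ?_, ?_⟩
  · simp only [Real.fourierInv_eq]
    refine (norm_integral_le_integral_norm _).trans ?_
    simp only [Circle.norm_smul, hGnorm, hg1, le_refl]
  · rw [tendsto_iff_norm_sub_tendsto_zero]
    -- The difference averages `exp (2πi ξ·x) - exp (i ω·x)` against a probability density on a ball
    -- of radius `1/(n+1)` about `ω/2π`, where the phases differ by at most `2π ‖x‖/(n+1)`.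
    have hle : ∀ n, ‖(𝓕⁻ (G n) : E d → ℂ) x - Complex.exp (Complex.I * (inner ℝ ω x : ℝ))‖
        ≤ 2 * Real.pi * ‖x‖ * (1 / ((n : ℝ) + 1)) := by
      intro n
      set e := Complex.exp (Complex.I * (inner ℝ ω x : ℝ)) with he
      have h1 : (𝓕⁻ (G n) : E d → ℂ) x - e
          = ∫ ξ, (Complex.exp ((2 * Real.pi * inner ℝ ξ x : ℝ) * Complex.I) - e) * G n ξ := by
        have h2 : ∫ ξ, e * G n ξ = e := by
          rw [integral_const_mul, hG, integral_complex_ofReal, hg1]; simp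
        have h3 : Integrable (fun ξ =>
            Complex.exp ((2 * Real.pi * inner ℝ ξ x : ℝ) * Complex.I) * G n ξ) volume := by
          refine (hgint n).mono' ?_ (ae_of_all _ fun ξ => ?_)
          · exact (by fun_prop : Continuous fun ξ : E d => Complex.exp
              ((2 * Real.pi * inner ℝ ξ x : ℝ) * Complex.I)).aestronglyMeasurable.mul
              (hGint n).aestronglyMeasurable
          · rw [norm_mul, Complex.norm_exp_ofReal_mul_I, one_mul, hGnorm]
        rw [Real.fourierInv_eq']
        nth_rw 1 [← h2]
        simp only [smul_eq_mul, sub_mul]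
        rw [integral_sub h3 ((hGint n).const_mul e)]
      rw [h1]
      have h4 : ∀ ξ, ‖(Complex.exp ((2 * Real.pi * inner ℝ ξ x : ℝ) * Complex.I) - e) * G n ξ‖
          ≤ 2 * Real.pi * ‖x‖ * (1 / ((n : ℝ) + 1)) * g n ξ := by
        intro ξ
        rw [norm_mul, hGnorm]
        by_cases hξ : ξ ∈ Metric.ball ((2 * Real.pi)⁻¹ • ω) (1 / ((n : ℝ) + 1))
        · refine mul_le_mul_of_nonneg_right ?_ (hg0 n ξ)
          rw [Metric.mem_ball, dist_eq_norm] at hξ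
          have h5 : Complex.exp ((2 * Real.pi * inner ℝ ξ x : ℝ) * Complex.I) - e
              = e * (Complex.exp (Complex.I *
                ((2 * Real.pi * inner ℝ (ξ - (2 * Real.pi)⁻¹ • ω) x : ℝ) : ℂ)) - 1) := by
            rw [mul_sub, mul_one, he, ← Complex.exp_add, inner_sub_left, inner_smul_left]
            congr 2
            have : (Real.pi : ℂ) ≠ 0 := by exact_mod_cast Real.pi_ne_zero
            push_cast
            simp only [conj_trivial]
            push_cast
            field_simp
            ring
          have h6 : ‖e‖ = 1 := by rw [he, mul_comm, Complex.norm_exp_ofReal_mul_I]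
          rw [h5, norm_mul, h6, one_mul]
          refine Real.norm_exp_I_mul_ofReal_sub_one_le.trans ?_
          have h7 : ‖(inner ℝ (ξ - (2 * Real.pi)⁻¹ • ω) x : ℝ)‖ ≤ ‖x‖ * (1 / ((n : ℝ) + 1)) := by
            refine (norm_inner_le_norm (𝕜 := ℝ) _ _).trans ?_
            rw [mul_comm]
            exact mul_le_mul_of_nonneg_left hξ.le (norm_nonneg _)
          rw [norm_mul, Real.norm_eq_abs, abs_of_pos (by positivity : (0 : ℝ) < 2 * Real.pi)]
          calc _ ≤ 2 * Real.pi * (‖x‖ * (1 / ((n : ℝ) + 1))) := by gcongr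
            _ = _ := by ring
        · simp only [hgB n ξ hξ, mul_zero, le_refl]
      calc _ ≤ ∫ ξ, 2 * Real.pi * ‖x‖ * (1 / ((n : ℝ) + 1)) * g n ξ :=
            norm_integral_le_of_norm_le ((hgint n).const_mul _) (ae_of_all _ h4)
        _ = _ := by rw [integral_const_mul, hg1, mul_one]
    refine squeeze_zero (fun n => norm_nonneg _) hle ?_
    simpa using (tendsto_one_div_add_atTop_nhds_zero_nat (𝕜 := ℝ)).const_mul (2 * Real.pi * ‖x‖)
  · have h1 : Tendsto (fun n => ‖sqrtKinetic T (φ n)‖ ^ 2) atTop (𝓝 0) := by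
      refine squeeze_zero (fun n => by positivity) (fun n => ?_)
        (tendsto_one_div_add_atTop_nhds_zero_nat (𝕜 := ℝ))
      rw [hφT]
      simp only [hGnorm]
      exact hgTle n
    simpa using h1.sqrt

end TrialFunctions

/-! ### Passing to the limiting quadratic form -/

section TrialFamilies

open Topology

variable {d k : ℕ} {T : E d → ℝ≥0} {V W : E d → ℝ}

theorem coeFn_finsetSum {ι : Type*} (s : Finset ι) (f : ι → L2 d) :
    ((∑ i ∈ s, f i : L2 d) : E d → ℂ) =ᵐ[volume] fun x => ∑ i ∈ s, f i x := by
  classical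
  induction s using Finset.induction_on with
  | empty => simpa using! Lp.coeFn_zero ℂ 2 (volume : Measure (E d))
  | insert i s hi ih =>
    rw [Finset.sum_insert hi]
    filter_upwards [Lp.coeFn_add (f i) (∑ i ∈ s, f i), ih] with x h1 h2
    rw [h1, Pi.add_apply, h2, Finset.sum_insert hi]

theorem re_schrodingerForm_self (φ : formDomain T) :
    (schrodingerForm T V φ φ).re
      = ‖sqrtKinetic T φ‖ ^ 2 + ∫ x, V x * ‖(φ : L2 d) x‖ ^ 2 := by
  have h1 : ∫ x, (V x : ℂ) * (conj ((φ : L2 d) x) * (φ : L2 d) x)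
      = ((∫ x, V x * ‖(φ : L2 d) x‖ ^ 2 : ℝ) : ℂ) := by
    rw [← integral_complex_ofReal]
    congr 1
    ext x
    rw [Complex.conj_mul']
    push_cast
    rfl
  have h2 : inner ℂ (sqrtKinetic T φ) (sqrtKinetic T φ) = ((‖sqrtKinetic T φ‖ ^ 2 : ℝ) : ℂ) := by
    rw [inner_self_eq_norm_sq_to_K]
    norm_cast
  rw [schrodingerForm, h1, h2, Complex.add_re, Complex.ofReal_re, Complex.ofReal_re]

theorem integrable_potential (hV : AEMeasurable V volume) {φ : L2 d}
    (h : InPotentialFormDomain V φ) : Integrable (fun x => V x * ‖φ x‖ ^ 2) volume := by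
  have h1 := (memLp_two_iff_integrable_sq_norm h.aestronglyMeasurable).1 h
  refine h1.mono' (hV.aestronglyMeasurable.mul ((Lp.aestronglyMeasurable φ).norm.pow 2))
    (ae_of_all _ fun x => ?_)
  rw [norm_mul, norm_mul, mul_pow, Complex.norm_real, Real.norm_eq_abs, Real.norm_eq_abs,
    Real.norm_eq_abs, abs_of_nonneg (Real.sqrt_nonneg _), Real.sq_sqrt (abs_nonneg _),
    abs_of_nonneg (by positivity : 0 ≤ ‖φ x‖ ^ 2)]

theorem integrable_mul_norm_sq {f : E d → ℂ} (hW : Integrable W volume)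
    (hf : AEStronglyMeasurable f volume) {C : ℝ} (hC : ∀ x, ‖f x‖ ≤ C) :
    Integrable (fun x => W x * ‖f x‖ ^ 2) volume := by
  refine hW.mul_bdd (c := C ^ 2) (hf.norm.pow 2) (ae_of_all _ fun x => ?_)
  rw [Real.norm_eq_abs, abs_of_nonneg (by positivity)]
  have := hC x
  gcongr

/-- If the limiting form of the trial functions `∑ c_l φ_l + ℓ(c) χ`, with the `φ_l` concentrating
near the `ω_l` in momentum space, is negative definite, then there are `k` negative
eigenvalues. -/
theorem hasAtLeastNegativeEigenvalues_of_limit (hT : AEMeasurable T volume)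
    (hV : AEMeasurable V volume) (hcomp : RelativelyFormCompact T V) {ω : Fin k → E d}
    (hthick : ∀ l, ThickZeroSetNear T (ω l)) (hW : Integrable W volume)
    (hVW : ∀ᵐ x, V x ≤ W x) (χ : formDomain T) {w : E d → ℂ}
    (hχ : ((χ : L2 d) : E d → ℂ) =ᵐ[volume] w) {C : ℝ} (hw : ∀ x, ‖w x‖ ≤ C)
    (ℓ : (Fin k → ℂ) →L[ℂ] ℂ)
    (hneg : ∀ c, c ≠ 0 → ‖ℓ c‖ ^ 2 * ‖sqrtKinetic T χ‖ ^ 2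
      + ∫ x, W x * ‖trigPoly ω c x + ℓ c * w x‖ ^ 2 < 0) :
    HasAtLeastNegativeEigenvalues T V k := by
  choose φ u hφu hu1 hulim hφT using fun l => exists_trial_sequence hT (hthick l)
  have hum : ∀ l n, AEStronglyMeasurable (u l n) volume := fun l n =>
    (Lp.aestronglyMeasurable _).congr (hφu l n)
  have hwm : AEStronglyMeasurable w volume := (Lp.aestronglyMeasurable _).congr hχ
  have hC0 : 0 ≤ C := (norm_nonneg _).trans (hw 0)
  set F : ℕ → (Fin k → ℂ) →ₗ[ℂ] formDomain T := fun n =>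
    Fintype.linearCombination ℂ (fun l => φ l n) + (ℓ : (Fin k → ℂ) →ₗ[ℂ] ℂ).smulRight χ with hF
  have hFapp : ∀ n c, F n c = ∑ l, c l • φ l n + ℓ c • χ := by
    intro n c
    simp [hF, Fintype.linearCombination_apply]
  set U : ℕ → (Fin k → ℂ) → E d → ℂ := fun n c x => ∑ l, c l * u l n x + ℓ c * w x with hU
  have hUm : ∀ n c, AEStronglyMeasurable (U n c) volume := by
    intro n c
    refine AEStronglyMeasurable.add ?_ (hwm.const_mul _)
    exact Finset.aestronglyMeasurable_fun_sum _ fun l _ => (hum l n).const_mul _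
  have hUle : ∀ n c x, ‖U n c x‖ ≤ ∑ l, ‖c l‖ + ‖ℓ c‖ * C := by
    intro n c x
    refine (norm_add_le _ _).trans (add_le_add ((norm_sum_le _ _).trans ?_) ?_)
    · refine Finset.sum_le_sum fun l _ => ?_
      rw [norm_mul]
      exact mul_le_of_le_one_right (norm_nonneg _) (hu1 l n x)
    · rw [norm_mul]
      exact mul_le_mul_of_nonneg_left (hw x) (norm_nonneg _)
  have hFU : ∀ n c, ((F n c : L2 d) : E d → ℂ) =ᵐ[volume] U n c := by
    intro n c
    have h1 : (F n c : L2 d) = ∑ l, c l • (φ l n : L2 d) + ℓ c • (χ : L2 d) := by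
      rw [hFapp]; push_cast; rfl
    rw [h1]
    have h2 : ∀ᵐ x, ∀ l, (c l • (φ l n : L2 d) : L2 d) x = c l * u l n x := by
      rw [ae_all_iff]
      intro l
      filter_upwards [Lp.coeFn_smul (c l) (φ l n : L2 d), hφu l n] with x hx1 hx2
      rw [hx1, Pi.smul_apply, hx2, smul_eq_mul]
    filter_upwards [Lp.coeFn_add (∑ l, c l • (φ l n : L2 d)) (ℓ c • (χ : L2 d)),
      coeFn_finsetSum Finset.univ (fun l => c l • (φ l n : L2 d)), h2,
      Lp.coeFn_smul (ℓ c) (χ : L2 d), hχ] with x h3 h4 h5 h6 h7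
    rw [h3, Pi.add_apply, h4, h6, Pi.smul_apply, h7]
    simp only [h5, smul_eq_mul, hU]
  set e : ℕ → (Fin k → ℂ) → ℝ := fun n c =>
    ‖sqrtKinetic T (F n c)‖ ^ 2 + ∫ x, W x * ‖U n c x‖ ^ 2 with he
  have hle : ∀ n c, (schrodingerForm T V (F n c) (F n c)).re ≤ e n c := by
    intro n c
    rw [re_schrodingerForm_self]
    refine add_le_add_right ?_ _
    refine integral_mono_ae (integrable_potential hV (hcomp.1 _ (F n c).2))
      (integrable_mul_norm_sq hW (hUm n c) (hUle n c)) ?_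
    filter_upwards [hFU n c, hVW] with x h1 h2
    rw [h1]
    gcongr
  have hhom : ∀ n (r : ℝ) c, e n ((r : ℂ) • c) = r ^ 2 * e n c := by
    intro n r c
    have h1 : sqrtKinetic T (F n ((r : ℂ) • c)) = (r : ℂ) • sqrtKinetic T (F n c) := by
      rw [map_smul, LinearPMap.map_smul]
    have h2 : ∀ x, U n ((r : ℂ) • c) x = (r : ℂ) * U n c x := by
      intro x
      simp only [hU, map_smul, Pi.smul_apply, smul_eq_mul, mul_add, Finset.mul_sum, mul_assoc]
    simp only [he, h1, h2, norm_smul, norm_mul, Complex.norm_real, mul_pow, Real.norm_eq_abs,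
      sq_abs, mul_add, ← integral_const_mul]
    congr 2
    ext x
    ring
  -- One `n` must serve all `c`. Otherwise homogeneity gives unit vectors `a n` with nonnegative
  -- energy, and a limit point of them contradicts `hneg`.
  suffices h : ∃ n, ∀ c, c ≠ 0 → e n c < 0 by
    obtain ⟨n, hn⟩ := h
    exact hasAtLeastNegativeEigenvalues_of_negative hT hV hcomp (F n)
      fun c hc => (hle n c).trans_lt (hn c hc)
  by_contra! hcon
  have hunit : ∀ n, ∃ c : Fin k → ℂ, c ∈ Metric.sphere (0 : Fin k → ℂ) 1 ∧ 0 ≤ e n c := by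
    intro n
    obtain ⟨c, hc, hec⟩ := hcon n
    refine ⟨((‖c‖⁻¹ : ℝ) : ℂ) • c, ?_, ?_⟩
    · rw [mem_sphere_zero_iff_norm, norm_smul, Complex.norm_real, norm_inv, norm_norm,
        inv_mul_cancel₀ (norm_ne_zero_iff.2 hc)]
    · rw [hhom]
      positivity
  choose a ha hea using hunit
  obtain ⟨c, hc, ψ, hψ, hlim⟩ := (isCompact_sphere (0 : Fin k → ℂ) 1).tendsto_subseq ha
  have hc0 : c ≠ 0 := by
    rintro rfl
    simp at hc
  have hlimc : ∀ l, Tendsto (fun n => a (ψ n) l) atTop (𝓝 (c l)) := fun l =>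
    (tendsto_pi_nhds.1 hlim) l
  have hlimℓ : Tendsto (fun n => ℓ (a (ψ n))) atTop (𝓝 (ℓ c)) := (ℓ.continuous.tendsto c).comp hlim
  have hkin : Tendsto (fun n => ‖sqrtKinetic T (F (ψ n) (a (ψ n)))‖ ^ 2) atTop
      (𝓝 (‖ℓ c‖ ^ 2 * ‖sqrtKinetic T χ‖ ^ 2)) := by
    have h1 : ∀ n b, sqrtKinetic T (F n b)
        = ∑ l, b l • sqrtKinetic T (φ l n) + ℓ b • sqrtKinetic T χ := by
      intro n b
      rw [hFapp]
      simp only [← LinearPMap.toFun_eq_coe, map_add, map_sum, map_smul]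
    have h2 : ∀ l, Tendsto (fun n => sqrtKinetic T (φ l (ψ n))) atTop (𝓝 0) := fun l =>
      (tendsto_zero_iff_norm_tendsto_zero.2 (hφT l)).comp hψ.tendsto_atTop
    have h3 : Tendsto (fun n => sqrtKinetic T (F (ψ n) (a (ψ n)))) atTop
        (𝓝 (∑ l : Fin k, c l • (0 : L2 d) + ℓ c • sqrtKinetic T χ)) := by
      simp only [h1]
      exact (tendsto_finsetSum _ fun l _ => (hlimc l).smul (h2 l)).add
        (hlimℓ.smul tendsto_const_nhds)
    have h4 := (h3.norm).pow 2
    simpa [norm_smul, mul_pow] using h4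
  have hpot : Tendsto (fun n => ∫ x, W x * ‖U (ψ n) (a (ψ n)) x‖ ^ 2) atTop
      (𝓝 (∫ x, W x * ‖trigPoly ω c x + ℓ c * w x‖ ^ 2)) := by
    -- A bound independent of `n`, since `‖a n‖ = 1` in the sup norm; `|W| D²` is the dominating
    -- function.
    set D : ℝ := ∑ _l : Fin k, 1 + ‖ℓ‖ * C with hD
    have hUD : ∀ n x, ‖U n (a n) x‖ ≤ D := by
      intro n x
      have hn : ‖a n‖ = 1 := mem_sphere_zero_iff_norm.1 (ha n)
      refine (hUle n (a n) x).trans (add_le_add (Finset.sum_le_sum fun l _ => ?_) ?_)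
      · exact (norm_le_pi_norm (a n) l).trans hn.le
      · refine mul_le_mul_of_nonneg_right ?_ hC0
        simpa [hn] using ℓ.le_opNorm (a n)
    refine tendsto_integral_of_dominated_convergence (fun x => |W x| * D ^ 2)
      (fun n => hW.aestronglyMeasurable.mul ((hUm _ _).norm.pow 2)) (hW.abs.mul_const _)
      (fun n => ae_of_all _ fun x => ?_) (ae_of_all _ fun x => ?_)
    · rw [Real.norm_eq_abs, abs_mul, abs_of_nonneg (by positivity : 0 ≤ ‖U (ψ n) (a (ψ n)) x‖ ^ 2)]
      have := hUD (ψ n) x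
      gcongr
    · refine Tendsto.const_mul _ (Tendsto.pow (Tendsto.norm ?_) 2)
      refine Tendsto.add (tendsto_finsetSum _ fun l _ => (hlimc l).mul ?_)
        (hlimℓ.mul_const _)
      exact (hulim l x).comp hψ.tendsto_atTop
  have hfinal := ge_of_tendsto' (hkin.add hpot) fun n => hea (ψ n)
  exact absurd (hneg c hc0) (not_lt.2 hfinal)

/-! ### Attractive potentials and negative definite matrices -/

theorem norm_trigPoly_le (ω : Fin k → E d) (c : Fin k → ℂ) (x : E d) :
    ‖trigPoly ω c x‖ ≤ ∑ l, ‖c l‖ := by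
  refine (norm_sum_le _ _).trans (Finset.sum_le_sum fun l _ => ?_)
  rw [norm_mul, mul_comm Complex.I, Complex.norm_exp_ofReal_mul_I, mul_one]

/-- If the limiting form `∫ W |∑ c_l exp (i ω_l · x)|²` is negative definite for some integrable
`W ≥ V`, then there are `k` negative eigenvalues. -/
theorem hasAtLeastNegativeEigenvalues_of_trigPoly (hT : AEMeasurable T volume)
    (hV : AEMeasurable V volume) (hcomp : RelativelyFormCompact T V) {ω : Fin k → E d}
    (hthick : ∀ l, ThickZeroSetNear T (ω l)) (hW : Integrable W volume)
    (hVW : ∀ᵐ x, V x ≤ W x)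
    (hneg : ∀ c, c ≠ 0 → ∫ x, W x * ‖trigPoly ω c x‖ ^ 2 < 0) :
    HasAtLeastNegativeEigenvalues T V k := by
  refine hasAtLeastNegativeEigenvalues_of_limit hT hV hcomp hthick hW hVW 0
    (w := fun _ => 0) (Lp.coeFn_zero ℂ 2 volume) (C := 0) (by simp) 0 fun c hc => ?_
  simpa using hneg c hc

/-- Attractive potentials. -/
theorem hasAtLeastNegativeEigenvalues_of_nonpos (hT : AEMeasurable T volume)
    (hV : AEMeasurable V volume) (hcomp : RelativelyFormCompact T V) {ω : Fin k → E d}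
    (hω : Function.Injective ω) (hthick : ∀ l, ThickZeroSetNear T (ω l))
    (hV0 : ¬ V =ᵐ[volume] 0) (hVneg : ∀ᵐ x, V x ≤ 0) :
    HasAtLeastNegativeEigenvalues T V k := by
  -- `V` need not be integrable. With `ρ ≤ 1` positive and integrable, `W = ρ V/(1+|V|)` is
  -- integrable, satisfies `V ≤ W ≤ 0` where `V ≤ 0`, and vanishes only where `V` does.
  set ρ : E d → ℝ := fun x => (1 + ‖x‖) ^ (-((d : ℝ) + 1)) with hρ
  have hρpos : ∀ x, 0 < ρ x := fun x => Real.rpow_pos_of_pos (by positivity) _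
  have hρ1 : ∀ x, ρ x ≤ 1 := fun x =>
    Real.rpow_le_one_of_one_le_of_nonpos (by linarith [norm_nonneg x]) (by linarith [d.cast_nonneg (α := ℝ)])
  have hρint : Integrable ρ volume := integrable_one_add_norm (by simp)
  set W : E d → ℝ := fun x => ρ x * (V x / (1 + |V x|)) with hWdef
  have hfrac : ∀ x, |V x / (1 + |V x|)| ≤ 1 := by
    intro x
    have : 0 < 1 + |V x| := by positivity
    rw [abs_div, abs_of_pos this, div_le_one this]
    linarith
  have hWint : Integrable W volume := by
    refine hρint.mul_bdd (c := 1) ?_ (ae_of_all _ hfrac)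
    exact (hV.div ((hV.norm).const_add 1)).aestronglyMeasurable
  have hWle : ∀ᵐ x, W x ≤ 0 := by
    filter_upwards [hVneg] with x hx
    exact mul_nonpos_of_nonneg_of_nonpos (hρpos x).le (div_nonpos_of_nonpos_of_nonneg hx (by positivity))
  have hVW : ∀ᵐ x, V x ≤ W x := by
    filter_upwards [hVneg] with x hx
    have h1 : 0 < 1 + |V x| := by positivity
    have h2 : V x ≤ V x / (1 + |V x|) := by
      rw [le_div_iff₀ h1]
      nlinarith [abs_nonneg (V x)]
    have h3 : V x / (1 + |V x|) ≤ 0 := div_nonpos_of_nonpos_of_nonneg hx h1.le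
    simp only [hWdef]
    nlinarith [hρ1 x]
  refine hasAtLeastNegativeEigenvalues_of_trigPoly hT hV hcomp hthick hWint hVW fun c hc => ?_
  have hint := integrable_mul_norm_sq hWint (continuous_trigPoly ω c).aestronglyMeasurable
    (norm_trigPoly_le ω c)
  have hle : ∀ᵐ x, 0 ≤ -(W x * ‖trigPoly ω c x‖ ^ 2) := by
    filter_upwards [hWle] with x hx
    rw [← neg_mul]
    exact mul_nonneg (by linarith) (by positivity)
  have hnn := integral_nonneg_of_ae hle
  rw [integral_neg] at hnn
  -- If the integral were zero, `W |p_c|²` would vanish a.e.; as `p_c ≠ 0` a.e., so would `V`.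
  refine lt_of_le_of_ne (by linarith) fun h0 => hV0 ?_
  have hz := (integral_eq_zero_iff_of_nonneg_ae hle hint.neg).1 (by rw [integral_neg, h0, neg_zero])
  filter_upwards [hz, trigPoly_ne_zero_ae hω hc] with x h1 h2
  simp only [Pi.zero_apply, neg_eq_zero, mul_eq_zero, hWdef, (hρpos x).ne', div_eq_zero_iff,
    false_or, pow_eq_zero_iff, norm_eq_zero, h2, or_false, ne_eq, OfNat.ofNat_ne_zero,
    not_false_eq_true] at h1
  rcases h1 with h1 | h1
  · exact h1
  · linarith [abs_nonneg (V x)]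

theorem integrable_mul_exp (hV : Integrable V volume) (η : E d) :
    Integrable (fun x => Complex.exp (-Complex.I * ((inner ℝ η x : ℝ) : ℂ)) * (V x : ℂ))
      volume := by
  refine hV.ofReal.bdd_mul (c := 1) (by fun_prop) (ae_of_all _ fun x => ?_)
  have e : -Complex.I * ((inner ℝ η x : ℝ) : ℂ) = ((-inner ℝ η x : ℝ) : ℂ) * Complex.I := by
    push_cast; ring
  rw [e, Complex.norm_exp_ofReal_mul_I]

/-- The quadratic form of the matrix `(V̂(ω_l - ω_m))` as an integral. -/
theorem dotProduct_potentialMatrix_mulVec (hV : Integrable V volume) (ω : Fin k → E d)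
    (c : Fin k → ℂ) :
    dotProduct (star c) (Matrix.mulVec (potentialMatrix V ω) c)
      = (((2 * Real.pi) ^ (-(d : ℝ) / 2) * ∫ x, V x * ‖trigPoly ω c x‖ ^ 2 : ℝ) : ℂ) := by
  have h1 : ∀ x, ((V x * ‖trigPoly ω c x‖ ^ 2 : ℝ) : ℂ) = ∑ l, ∑ m, conj (c l) * c m *
      (Complex.exp (-Complex.I * ((inner ℝ (ω l - ω m) x : ℝ) : ℂ)) * (V x : ℂ)) := by
    intro x
    push_cast
    rw [← Complex.conj_mul', trigPoly, map_sum, Finset.sum_mul_sum, Finset.mul_sum]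
    refine Finset.sum_congr rfl fun l _ => ?_
    rw [Finset.mul_sum]
    refine Finset.sum_congr rfl fun m _ => ?_
    have h2 : Complex.exp (-Complex.I * ((inner ℝ (ω l - ω m) x : ℝ) : ℂ))
        = conj (Complex.exp (Complex.I * (inner ℝ (ω l) x : ℝ)))
          * Complex.exp (Complex.I * (inner ℝ (ω m) x : ℝ)) := by
      rw [← Complex.exp_conj, ← Complex.exp_add, map_mul, Complex.conj_I, Complex.conj_ofReal,
        inner_sub_left]
      congr 1
      push_cast
      ring
    rw [h2, map_mul]
    ring
  have h3 : ((∫ x, V x * ‖trigPoly ω c x‖ ^ 2 : ℝ) : ℂ) = ∑ l, ∑ m, conj (c l) * c m *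
      ∫ x, Complex.exp (-Complex.I * ((inner ℝ (ω l - ω m) x : ℝ) : ℂ)) * (V x : ℂ) := by
    rw [← integral_complex_ofReal]
    simp only [h1]
    rw [integral_finsetSum _ fun l _ => integrable_finsetSum _ fun m _ =>
      (integrable_mul_exp hV _).const_mul _]
    refine Finset.sum_congr rfl fun l _ => ?_
    rw [integral_finsetSum _ fun m _ => (integrable_mul_exp hV _).const_mul _]
    refine Finset.sum_congr rfl fun m _ => ?_
    rw [integral_const_mul]
  rw [Complex.ofReal_mul, h3]
  simp only [dotProduct, Matrix.mulVec, potentialMatrix, Matrix.of_apply, potentialHat,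
    Finset.mul_sum, Pi.star_apply, RCLike.star_def]
  refine Finset.sum_congr rfl fun l _ => Finset.sum_congr rfl fun m _ => ?_
  ring

/-- Integrable potentials whose matrix `(V̂(ω_l - ω_m))` is negative definite. -/
theorem hasAtLeastNegativeEigenvalues_of_negDef (hT : AEMeasurable T volume)
    (hcomp : RelativelyFormCompact T V) {ω : Fin k → E d}
    (hthick : ∀ l, ThickZeroSetNear T (ω l)) (hV : Integrable V volume)
    (hM : (-potentialMatrix V ω).PosDef) :
    HasAtLeastNegativeEigenvalues T V k := by
  refine hasAtLeastNegativeEigenvalues_of_trigPoly hT hV.aestronglyMeasurable.aemeasurable hcomp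
    hthick hV (ae_of_all _ fun x => le_rfl) fun c hc => ?_
  have h1 := hM.dotProduct_mulVec_pos hc
  rw [Matrix.neg_mulVec, dotProduct_neg, dotProduct_potentialMatrix_mulVec hV,
    ← Complex.ofReal_neg, Complex.zero_lt_real, neg_pos] at h1
  exact (pos_iff_neg_of_mul_neg h1).1 (Real.rpow_pos_of_pos (by positivity) _)

end TrialFamilies

/-! ### Semidefinite matrices with simple eigenvalue zero -/

section Degenerate

open Topology SchwartzMap

variable {d k : ℕ} {T : E d → ℝ≥0} {V : E d → ℝ}

/-- Degenerate second order perturbation of a negative semidefinite form: if `b` is negative on the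
null vectors of `q ≤ 0`, then `q + ε b + ε² a` is negative definite for some `ε > 0`. -/
theorem exists_perturbation_neg {q b a : (Fin k → ℂ) → ℝ} (hq : Continuous q) (hb : Continuous b)
    (ha : Continuous a) (hqh : ∀ (r : ℝ) c, q ((r : ℂ) • c) = r ^ 2 * q c)
    (hbh : ∀ (r : ℝ) c, b ((r : ℂ) • c) = r ^ 2 * b c)
    (hah : ∀ (r : ℝ) c, a ((r : ℂ) • c) = r ^ 2 * a c) (hq0 : ∀ c, q c ≤ 0)
    (hqb : ∀ c, c ≠ 0 → q c = 0 → b c < 0) :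
    ∃ ε : ℝ, 0 < ε ∧ ∀ c, c ≠ 0 → q c + ε * b c + ε ^ 2 * a c < 0 := by
  by_contra! hcon
  set ε : ℕ → ℝ := fun n => 1 / ((n : ℝ) + 1) with hε
  have hεpos : ∀ n, 0 < ε n := fun n => by positivity
  have hεlim : Tendsto ε atTop (𝓝 0) := tendsto_one_div_add_atTop_nhds_zero_nat
  have hunit : ∀ n, ∃ c : Fin k → ℂ, c ∈ Metric.sphere (0 : Fin k → ℂ) 1 ∧
      0 ≤ q c + ε n * b c + ε n ^ 2 * a c := by
    intro n
    obtain ⟨c, hc, hec⟩ := hcon (ε n) (hεpos n)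
    refine ⟨((‖c‖⁻¹ : ℝ) : ℂ) • c, ?_, ?_⟩
    · rw [mem_sphere_zero_iff_norm, norm_smul, Complex.norm_real, norm_inv, norm_norm,
        inv_mul_cancel₀ (norm_ne_zero_iff.2 hc)]
    · rw [hqh, hbh, hah]
      have e : ‖c‖⁻¹ ^ 2 * q c + ε n * (‖c‖⁻¹ ^ 2 * b c) + ε n ^ 2 * (‖c‖⁻¹ ^ 2 * a c)
          = ‖c‖⁻¹ ^ 2 * (q c + ε n * b c + ε n ^ 2 * a c) := by ring
      rw [e]
      positivity
  choose u hu hue using hunit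
  obtain ⟨c, hc, ψ, hψ, hlim⟩ := (isCompact_sphere (0 : Fin k → ℂ) 1).tendsto_subseq hu
  have hc0 : c ≠ 0 := by
    rintro rfl
    simp at hc
  have hql := (hq.tendsto c).comp hlim
  have hbl := (hb.tendsto c).comp hlim
  have hal := (ha.tendsto c).comp hlim
  have hεl := hεlim.comp hψ.tendsto_atTop
  have h1 := ge_of_tendsto' ((hql.add (hεl.mul hbl)).add ((hεl.pow 2).mul hal))
    fun n => hue (ψ n)
  -- The limit vector is a null vector of `q`. Dropping the terms `q ≤ 0` and dividing by `ε` before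
  -- a second limit gives `b c ≥ 0`, the contradiction.
  have h2 : q c = 0 := le_antisymm (hq0 c) (by simpa using h1)
  have h3 : ∀ n, 0 ≤ b (u (ψ n)) + ε (ψ n) * a (u (ψ n)) := by
    intro n
    have h4 := hue (ψ n)
    have h5 := hq0 (u (ψ n))
    have h6 : 0 ≤ ε (ψ n) * (b (u (ψ n)) + ε (ψ n) * a (u (ψ n))) := by nlinarith
    exact nonneg_of_mul_nonneg_right h6 (hεpos _)
  have h7 := ge_of_tendsto' (hbl.add (hεl.mul hal)) h3
  have h8 := hqb c hc0 h2
  simp only [zero_mul, add_zero] at h7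
  linarith

/-- The inverse Fourier transform is injective on `L¹`. -/
theorem ae_eq_zero_of_fourierInv_ae_eq_zero {f : E d → ℂ} (hf : Integrable f volume)
    (h0 : ∀ᵐ x, (𝓕⁻ f : E d → ℂ) x = 0) : ∀ᵐ x, f x = 0 := by
  refine ae_eq_zero_of_integral_contDiff_smul_eq_zero hf.locallyIntegrable fun s hs hsc => ?_
  have hs₁ : HasCompactSupport (Complex.ofRealCLM ∘ s) := hsc.comp_left rfl
  have hs₂ : ContDiff ℝ ((⊤ : ℕ∞) : WithTop ℕ∞) (Complex.ofRealCLM ∘ s) := by fun_prop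
  set S : 𝓢(E d, ℂ) := hs₁.toSchwartzMap hs₂ with hS
  -- Writing the test function as an inverse transform moves `𝓕⁻` onto `f`, where it vanishes.
  have hSs : ∀ x, s x • f x = (𝓕⁻ ((𝓕 S : 𝓢(E d, ℂ)) : E d → ℂ) : E d → ℂ) x • f x := by
    intro x
    rw [← SchwartzMap.fourierInv_coe, FourierTransform.fourierInv_fourier_eq]
    simp [hS]
  simp only [hSs]
  rw [integral_fourierInv_smul (SchwartzMap.integrable _) hf]
  refine integral_eq_zero_of_ae ?_
  filter_upwards [h0] with x hx
  simp [hx]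

/-- For locally bounded `T`, smooth compactly supported functions on the frequency side separate
integrable functions. -/
theorem exists_formDomain_integral_eq (hT : AEMeasurable T volume) (hTb : LocallyBounded T)
    {f : E d → ℂ} (hf : Integrable f volume) (hf0 : ¬ f =ᵐ[volume] 0) (z : ℂ) :
    ∃ (χ : formDomain T) (w : E d → ℂ) (C : ℝ), ((χ : L2 d) : E d → ℂ) =ᵐ[volume] w ∧
      Continuous w ∧ (∀ x, ‖w x‖ ≤ C) ∧ ∫ x, conj (w x) * f x = z := by
  have hconj : Integrable (fun x => conj (f x)) volume :=
    hf.norm.mono' (Complex.continuous_conj.comp_aestronglyMeasurable hf.aestronglyMeasurable)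
      (ae_of_all _ fun x => by simp)
  obtain ⟨s, hs, hsc, hne⟩ : ∃ s : E d → ℝ, ContDiff ℝ ((⊤ : ℕ∞) : WithTop ℕ∞) s ∧
      HasCompactSupport s ∧ ∫ x, s x • (𝓕⁻ (fun x => conj (f x)) : E d → ℂ) x ≠ 0 := by
    by_contra! hcon
    refine hf0 ?_
    have h1 := ae_eq_zero_of_fourierInv_ae_eq_zero hconj
      (ae_eq_zero_of_integral_contDiff_smul_eq_zero (continuous_fourierInv hconj).locallyIntegrable
        hcon)
    filter_upwards [h1] with x hx
    simpa using hx
  set g : E d → ℂ := fun ξ => (s ξ : ℂ) with hg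
  have hgc : Continuous g := by
    have := hs.continuous
    fun_prop
  have hgs : HasCompactSupport g := hsc.comp_left (g := Complex.ofReal) rfl
  have hgint : Integrable g volume := hgc.integrable_of_hasCompactSupport hgs
  have hg2 : MemLp g 2 volume := hgc.memLp_of_hasCompactSupport hgs
  -- Local boundedness enters here: `T` is bounded on the dilated support of `g`, so compactly
  -- supported momentum profiles have finite kinetic energy.
  have hTg : MemLp (fun ξ => ((Real.sqrt (T ((2 * Real.pi) • ξ)) : ℝ) : ℂ) * g ξ) 2 volume := by
    obtain ⟨D, hD⟩ := hTb ((fun ξ => (2 * Real.pi) • ξ) '' tsupport g)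
      (hgs.isCompact.image (by fun_prop))
    refine (hg2.const_mul ((Real.sqrt D : ℝ) : ℂ)).of_le ?_ (ae_of_all _ fun ξ => ?_)
    · exact ((Complex.measurable_ofReal.comp_aemeasurable
        (aemeasurable_dilation hT).sqrt).aestronglyMeasurable).mul hgint.aestronglyMeasurable
    · by_cases hξ : ξ ∈ tsupport g
      · simp only [norm_mul, Complex.norm_real, Real.norm_eq_abs,
          abs_of_nonneg (Real.sqrt_nonneg _)]
        refine mul_le_mul_of_nonneg_right (Real.sqrt_le_sqrt ?_) (norm_nonneg _)
        exact_mod_cast hD ⟨_, ⟨ξ, hξ, rfl⟩, rfl⟩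
      · simp [image_eq_zero_of_notMem_tsupport hξ]
  obtain ⟨χ, hχ, -⟩ := exists_formDomain_fourierInv hgint hg2 hTg
  set I := ∫ x, conj ((𝓕⁻ g : E d → ℂ) x) * f x with hI
  have hI0 : I ≠ 0 := by
    have h1 : conj I = ∫ x, s x • (𝓕⁻ (fun x => conj (f x)) : E d → ℂ) x := by
      have h2 := integral_fourierInv_smul hgint hconj
      rw [hI, ← integral_conj]
      simp only [map_mul, Complex.conj_conj]
      simp only [smul_eq_mul] at h2
      rw [h2]
      simp only [hg, Complex.real_smul]
    intro h3
    rw [h3, map_zero] at h1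
    exact hne h1.symm
  -- Rescaling turns the nonzero pairing `I` into the prescribed value `z`; the conjugate undoes the
  -- one in the pairing.
  set α : ℂ := conj (z / I) with hα
  refine ⟨α • χ, fun x => α * (𝓕⁻ g : E d → ℂ) x, ‖α‖ * ∫ ξ, ‖g ξ‖, ?_, ?_, fun x => ?_, ?_⟩
  · filter_upwards [Lp.coeFn_smul α (χ : L2 d), hχ] with x h1 h2
    rw [Submodule.coe_smul, h1, Pi.smul_apply, h2, smul_eq_mul]
  · exact continuous_const.mul (continuous_fourierInv hgint)
  · rw [norm_mul]
    refine mul_le_mul_of_nonneg_left ?_ (norm_nonneg _)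
    rw [Real.fourierInv_eq]
    refine (norm_integral_le_integral_norm _).trans ?_
    simp only [Circle.norm_smul, le_refl]
  · simp only [map_mul, hα, Complex.conj_conj, mul_assoc]
    rw [integral_const_mul, ← hI, div_mul_cancel₀ _ hI0]

theorem trigPoly_smul (ω : Fin k → E d) (r : ℂ) (c : Fin k → ℂ) (x : E d) :
    trigPoly ω (r • c) x = r * trigPoly ω c x := by
  simp only [trigPoly, Pi.smul_apply, smul_eq_mul, Finset.mul_sum, mul_assoc]

/-- Integrable potentials whose matrix `(V̂(ω_l - ω_m))` is negative semidefinite with simple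
eigenvalue zero, for locally bounded kinetic energies. -/
theorem hasAtLeastNegativeEigenvalues_of_negSemidef (hT : AEMeasurable T volume)
    (hTb : LocallyBounded T) (hcomp : RelativelyFormCompact T V) {ω : Fin k → E d}
    (hω : Function.Injective ω) (hthick : ∀ l, ThickZeroSetNear T (ω l))
    (hV : Integrable V volume) (hV0 : ¬ V =ᵐ[volume] 0)
    (hM : (-potentialMatrix V ω).PosSemidef)
    (hker : Module.finrank ℂ
      (Module.End.eigenspace (Matrix.toLin' (potentialMatrix V ω)) 0) = 1) :
    HasAtLeastNegativeEigenvalues T V k := by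
  have hVm := hV.aestronglyMeasurable.aemeasurable
  obtain ⟨v, hv0, hv⟩ : ∃ v : Fin k → ℂ, v ≠ 0 ∧
      ∀ c, Matrix.mulVec (potentialMatrix V ω) c = 0 → ∃ r : ℂ, c = r • v := by
    obtain ⟨⟨v, hvmem⟩, hv0, hv⟩ := finrank_eq_one_iff'.1 hker
    refine ⟨v, fun h => hv0 (Subtype.ext h), fun c hc => ?_⟩
    obtain ⟨r, hr⟩ := hv ⟨c, by simpa [Module.End.mem_eigenspace_iff] using hc⟩
    exact ⟨r, (congrArg Subtype.val hr).symm⟩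
  obtain ⟨s, hs⟩ := SeparatingDual.exists_eq_one (R := ℂ) hv0
  have hVt : ∀ c, Integrable (fun x => (V x : ℂ) * trigPoly ω c x) volume := fun c =>
    hV.ofReal.mul_bdd (c := ∑ l, ‖c l‖) (continuous_trigPoly ω c).aestronglyMeasurable
      (ae_of_all _ (norm_trigPoly_le ω c))
  have hVt0 : ¬ (fun x => (V x : ℂ) * trigPoly ω v x) =ᵐ[volume] 0 := by
    intro h
    refine hV0 ?_
    filter_upwards [h, trigPoly_ne_zero_ae hω hv0] with x h1 h2
    simpa [h2] using h1
  -- `χ` couples to `V p_v` with value `-1`. Since `s v = 1`, the cross term `b` equals `-2 |r|²` at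
  -- a null vector `r v`, so it is negative exactly where the matrix form fails to be.
  obtain ⟨χ, w, C, hχ, hwc, hwC, hχv⟩ := exists_formDomain_integral_eq hT hTb (hVt v) hVt0 (-1)
  set q : (Fin k → ℂ) → ℝ := fun c => ∫ x, V x * ‖trigPoly ω c x‖ ^ 2 with hq
  set L : (Fin k → ℂ) → ℂ := fun c => ∫ x, conj (w x) * ((V x : ℂ) * trigPoly ω c x) with hL
  set b : (Fin k → ℂ) → ℝ := fun c => 2 * (conj (s c) * L c).re with hb
  set A : ℝ := ‖sqrtKinetic T χ‖ ^ 2 + ∫ x, V x * ‖w x‖ ^ 2 with hA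
  set κ : ℝ := (2 * Real.pi) ^ (-(d : ℝ) / 2) with hκ
  have hκpos : 0 < κ := Real.rpow_pos_of_pos (by positivity) _
  have hquad : ∀ c, dotProduct (star c) (Matrix.mulVec (potentialMatrix V ω) c)
      = ((κ * q c : ℝ) : ℂ) := dotProduct_potentialMatrix_mulVec hV ω
  have hLint : ∀ c, Integrable (fun x => conj (w x) * ((V x : ℂ) * trigPoly ω c x)) volume :=
    fun c => (hVt c).bdd_mul (c := C)
      (Complex.continuous_conj.comp hwc).aestronglyMeasurable
      (ae_of_all _ fun x => by simpa using hwC x)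
  have hLsum : ∀ c, L c = ∑ l, c l * L (Pi.single l 1) := by
    intro c
    simp only [hL, ← integral_const_mul]
    rw [← integral_finsetSum _ fun l _ => (hLint _).const_mul _]
    congr 1
    ext x
    have h1 : ∀ l : Fin k, trigPoly ω (Pi.single l 1) x
        = Complex.exp (Complex.I * (inner ℝ (ω l) x : ℝ)) := by
      intro l
      rw [trigPoly, Finset.sum_eq_single l]
      · simp
      · intro m _ hm
        simp [Pi.single_eq_of_ne hm]
      · simp
    simp only [h1]
    rw [trigPoly, Finset.mul_sum, Finset.mul_sum]
    refine Finset.sum_congr rfl fun l _ => ?_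
    ring
  have hLsmul : ∀ (r : ℂ) c, L (r • c) = r * L c := by
    intro r c
    rw [hLsum, hLsum c, Finset.mul_sum]
    simp only [Pi.smul_apply, smul_eq_mul, mul_assoc]
  have hLcont : Continuous L := by
    rw [funext hLsum]
    fun_prop
  have hqcont : Continuous q := by
    have h1 : q = fun c =>
        κ⁻¹ * (dotProduct (star c) (Matrix.mulVec (potentialMatrix V ω) c)).re := by
      ext c
      rw [hquad, Complex.ofReal_re, ← mul_assoc, inv_mul_cancel₀ hκpos.ne', one_mul]
    rw [h1]
    refine continuous_const.mul (Complex.continuous_re.comp ?_)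
    exact continuous_star.dotProduct (continuous_const.matrix_mulVec continuous_id)
  have hneg : ∀ c, dotProduct (star c) (Matrix.mulVec (-potentialMatrix V ω) c)
      = ((-(κ * q c) : ℝ) : ℂ) := by
    intro c
    rw [Matrix.neg_mulVec, dotProduct_neg, hquad, Complex.ofReal_neg]
  obtain ⟨ε, hε, hεneg⟩ := exists_perturbation_neg (q := q) (b := b)
    (a := fun c => ‖s c‖ ^ 2 * A) hqcont
    (by
      have := s.continuous
      exact continuous_const.mul (Complex.continuous_re.comp
        ((Complex.continuous_conj.comp this).mul hLcont)))
    (by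
      have := s.continuous
      fun_prop)
    (fun r c => by
      simp only [hq, trigPoly_smul, norm_mul, Complex.norm_real, mul_pow, Real.norm_eq_abs, sq_abs,
        ← integral_const_mul]
      congr 1
      ext x
      ring)
    (fun r c => by
      have h1 : conj (s ((r : ℂ) • c)) * L ((r : ℂ) • c)
          = ((r ^ 2 : ℝ) : ℂ) * (conj (s c) * L c) := by
        rw [map_smul, hLsmul, smul_eq_mul, map_mul, Complex.conj_ofReal]
        push_cast
        ring
      simp only [hb]
      rw [h1, Complex.re_ofReal_mul]
      ring)
    (fun r c => by
      simp only [map_smul, norm_smul, Complex.norm_real, mul_pow, Real.norm_eq_abs, sq_abs,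
        mul_assoc])
    (fun c => by
      have h1 := hM.dotProduct_mulVec_nonneg c
      rw [hneg, Complex.zero_le_real] at h1
      nlinarith)
    (fun c hc hqc => by
      have h1 : dotProduct (star c) (Matrix.mulVec (-potentialMatrix V ω) c) = 0 := by
        rw [hneg, hqc]; simp
      rw [hM.dotProduct_mulVec_zero_iff, Matrix.neg_mulVec, neg_eq_zero] at h1
      obtain ⟨r, rfl⟩ := hv c h1
      have hr : r ≠ 0 := by
        rintro rfl
        simp at hc
      have h2 : conj (s (r • v)) * L (r • v) = ((-‖r‖ ^ 2 : ℝ) : ℂ) := by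
        have h3 : L v = -1 := hχv
        rw [map_smul, hLsmul, hs, h3, smul_eq_mul, mul_one, ← mul_assoc, Complex.conj_mul']
        push_cast
        ring
      simp only [hb]
      rw [h2, Complex.ofReal_re]
      have := norm_pos_iff.2 hr
      nlinarith [sq_pos_of_pos this])
  refine hasAtLeastNegativeEigenvalues_of_limit hT hVm hcomp hthick hV
    (ae_of_all _ fun x => le_rfl) χ hχ hwC ((ε : ℂ) • s) fun c hc => ?_
  refine lt_of_eq_of_lt ?_ (hεneg c hc)
  -- Expanding the square with `ℓ = ε s` identifies the limiting energy, including the kinetic term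
  -- of `χ`, with `q + ε b + ε² |s c|² A`.
  have hp : ∀ x, V x * ‖trigPoly ω c x + ((ε : ℂ) • s) c * w x‖ ^ 2
      = V x * ‖trigPoly ω c x‖ ^ 2
        + (2 * ε) * (conj (s c) * (conj (w x) * ((V x : ℂ) * trigPoly ω c x))).re
        + (ε ^ 2 * ‖s c‖ ^ 2) * (V x * ‖w x‖ ^ 2) := by
    intro x
    have h1 : ((ε : ℂ) • s) c = (ε : ℂ) * s c := rfl
    have h2 : conj (s c) * (conj (w x) * ((V x : ℂ) * trigPoly ω c x))
        = (V x : ℂ) * (trigPoly ω c x * conj (s c * w x)) := by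
      rw [map_mul]
      ring
    have h3 : trigPoly ω c x * conj ((ε : ℂ) * s c * w x)
        = (ε : ℂ) * (trigPoly ω c x * conj (s c * w x)) := by
      rw [mul_assoc, map_mul, Complex.conj_ofReal]
      ring
    rw [h2, Complex.re_ofReal_mul, h1, ← Complex.normSq_eq_norm_sq, Complex.normSq_add, h3,
      Complex.re_ofReal_mul, Complex.normSq_eq_norm_sq, Complex.normSq_eq_norm_sq, norm_mul,
      norm_mul, Complex.norm_real, mul_pow, mul_pow, Real.norm_eq_abs, sq_abs]
    ring
  have i1 := integrable_mul_norm_sq hV (continuous_trigPoly ω c).aestronglyMeasurable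
    (norm_trigPoly_le ω c)
  have i2 : Integrable (fun x =>
      2 * ε * (conj (s c) * (conj (w x) * ((V x : ℂ) * trigPoly ω c x))).re) volume :=
    ((hLint c).const_mul (conj (s c))).re.const_mul (2 * ε)
  have i3 := integrable_mul_norm_sq hV hwc.aestronglyMeasurable hwC
  have hre : ∫ x, (conj (s c) * (conj (w x) * ((V x : ℂ) * trigPoly ω c x))).re
      = (conj (s c) * L c).re := by
    have := integral_re ((hLint c).const_mul (conj (s c)))
    rw [integral_const_mul] at this
    exact this
  have hnorm : ‖((ε : ℂ) • s) c‖ ^ 2 = ε ^ 2 * ‖s c‖ ^ 2 := by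
    rw [show ((ε : ℂ) • s) c = (ε : ℂ) * s c from rfl, norm_mul, mul_pow, Complex.norm_real,
      Real.norm_eq_abs, sq_abs]
  simp only [hp]
  have i12 : Integrable (fun x => V x * ‖trigPoly ω c x‖ ^ 2 +
      2 * ε * (conj (s c) * (conj (w x) * ((V x : ℂ) * trigPoly ω c x))).re) volume := i1.add i2
  rw [integral_add i12 (i3.const_mul _), integral_add i1 i2, integral_const_mul,
    integral_const_mul, hnorm, hre]
  simp only [hq, hb, hA]
  ring

end Degenerate

end ManyBoundStates

/-! ### The main theorem -/

theorem theorem2p3 {d : ℕ} (hd : 1 ≤ d) (k : ℕ)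
    (T : ManyBoundStates.E d → ℝ≥0) (hT : AEMeasurable T volume)
    (ω : Fin k → ManyBoundStates.E d) (hω : Function.Injective ω)
    (hthick : ∀ l, ManyBoundStates.ThickZeroSetNear T (ω l))
    (V : ManyBoundStates.E d → ℝ) (hV : AEMeasurable V volume)
    (hV0 : ¬ V =ᵐ[volume] 0)
    (hcomp : ManyBoundStates.RelativelyFormCompact T V) :
    ((∀ᵐ x ∂volume, V x ≤ 0) → ManyBoundStates.HasAtLeastNegativeEigenvalues T V k) ∧
    (Integrable V volume → (-ManyBoundStates.potentialMatrix V ω).PosDef →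
      ManyBoundStates.HasAtLeastNegativeEigenvalues T V k) ∧
    (Integrable V volume → ManyBoundStates.LocallyBounded T →
      (-ManyBoundStates.potentialMatrix V ω).PosSemidef →
      Module.finrank ℂ
        (Module.End.eigenspace (Matrix.toLin' (ManyBoundStates.potentialMatrix V ω)) 0) = 1 →
      ManyBoundStates.HasAtLeastNegativeEigenvalues T V k) := by
  refine ⟨fun h => ?_, fun hint hM => ?_, fun hint hTb hM hker => ?_⟩
  · exact ManyBoundStates.hasAtLeastNegativeEigenvalues_of_nonpos hT hV hcomp hω hthick hV0 h
  · exact ManyBoundStates.hasAtLeastNegativeEigenvalues_of_negDef hT hcomp hthick hint hM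
  · exact ManyBoundStates.hasAtLeastNegativeEigenvalues_of_negSemidef hT hTb hcomp hω hthick hint
      hV0 hM hker
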